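/- Let $L\in(0,1)$, let $\gamma_1$ be the standard Gaussian measure on $\mathbb R$, and let $\operatorname{erf}(x)=\frac{2}{\sqrt\pi}\int_0^x e^{-t^2}\,dt$, with $\operatorname{erf}(\pm\infty)=\pm1$ and inverse $\operatorname{erf}^{-1}:[-1,1]\to[-\infty,+\infty]$. For $-\infty\le a<b\le+\infty$ let $H^1((a,b),\gamma_1)$ be the space of all $u\in W^{1,1}_{\mathrm{loc}}(a,b)$ with $u,u'\in L^2((a,b),\gamma_1)$, and let $\mu_1(a,b)$ be the first nontrivial (that is, smallest nonzero) eigenvalue of the Neumann problem $$-u''+xu'=\mu u\ \text{ in }(a,b),\qquad u'(a)=u'(b)=0,$$ understood in the weak sense: $\mu$ is an eigenvalue if there is $0\ne u\in H^1((a,b),\gamma_1)$ with $\int_a^b u'v'\,d\gamma_1=\mu\int_a^b uv\,d\gamma_1$ for all $v\in H^1((a,b),\gamma_1)$. Put $$b(a)=\sqrt2\operatorname{erf}^{-1}\!\Big[2L+\operatorname{erf}\Big(\tfrac{\sqrt2}{2}a\Big)\Big],\qquad -\infty\le a\le \sqrt2\operatorname{erf}^{-1}(1-2L).$$ Then the intervals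 $(a,b)$ with $-\infty\le a<b\le+\infty$ and $\gamma_1(a,b)=L$ are exactly the intervals $(a,b(a))$ with $a\in[-\infty,\sqrt2\operatorname{erf}^{-1}(1-2L)]$; for each of them the first nontrivial eigenvalue $\mu_1(a,b(a))$ exists and is positive; and, with $a$ ranging over $[-\infty,\sqrt2\operatorname{erf}^{-1}(1-2L)]$, $$\min_a\mu_1(a,b(a))=\mu_1\big(-\infty,\sqrt2\operatorname{erf}^{-1}(2L-1)\big)=\mu_1\big(\sqrt2\operatorname{erf}^{-1}(1-2L),+\infty\big),$$ $$\max_a\mu_1(a,b(a))=\mu_1\big(-\sqrt2\operatorname{erf}^{-1}(L),\sqrt2\operatorname{erf}^{-1}(L)\big).$$ Furthermore, the function $a\mapsto\mu_1(a,b(a))$ is strictly increasing on $[-\infty,-\sqrt2\operatorname{erf}^{-1}(L)]$. It is invariant under the reflection $(a,b(a))\mapsto(-b(a),-a)$ of the interval, that is, $-b(a)$ again lies in $[-\infty,\sqrt2\operatorname{erf}^{-1}(1-2L)]$ and $\mu_1(-b(a),b(-b(a)))=\mu_1(a,b(a))$; and it is strictly decreasing on $[-\sqrt2\operatorname{erf}^{-1}(L),\sqrt2\operatorname{erf}^{-1}(1-2L)]$.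 -/

import Mathlib

open MeasureTheory ProbabilityTheory Set
open scoped ContDiff

namespace GaussNeumann

noncomputable section

/-- The error function on the real line. -/
def erf (x : ℝ) : ℝ := 2 / Real.sqrt Real.pi * ∫ t in (0 : ℝ)..x, Real.exp (-t ^ 2)

/-- The error function on the extended real line, with its limits `-1` and `1` at the ends. -/
def erfE : EReal → ℝ
  | ⊥ => -1
  | ⊤ => 1
  | (x : ℝ) => erf x

/-- The inverse of the error function. It is meaningful on `[-1, 1]`, the range of `erfE`. -/
def erfInv : ℝ → EReal := Function.invFun erfE

/-- The multiple `√2 erf⁻¹(y)`. -/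
def sqrtTwoErfInv (y : ℝ) : EReal := ((Real.sqrt 2 : ℝ) : EReal) * erfInv y

/-- The one-dimensional standard Gaussian measure. -/
def gauss : Measure ℝ := gaussianReal 0 1

/-- The open interval `(a, b)` of the real line, whose endpoints may be infinite. -/
def interval (a b : EReal) : Set ℝ := {x : ℝ | a < (x : EReal) ∧ (x : EReal) < b}

/-- The right endpoint `b(a) = √2 erf⁻¹(2 L + erf(a √2 / 2))`. -/
def rightEnd (L : ℝ) (a : EReal) : EReal :=
  sqrtTwoErfInv (2 * L + erfE (((Real.sqrt 2 / 2 : ℝ) : EReal) * a))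

/-- `u` belongs to `W^{1,1}_loc(I)` and has the weak derivative `g` on the open set `I`. -/
structure HasWeakDerivOn (I : Set ℝ) (u g : ℝ → ℝ) : Prop where
  locInt : LocallyIntegrableOn u I volume
  locInt_deriv : LocallyIntegrableOn g I volume
  integral_eq : ∀ φ : ℝ → ℝ, ContDiff ℝ ∞ φ → HasCompactSupport φ → tsupport φ ⊆ I →
    ∫ x in I, u x * deriv φ x = - ∫ x in I, g x * φ x

/-- `u` belongs to the Gaussian Sobolev space `H¹(I, γ)` and has the weak derivative `g`. -/
structure IsSobolev (I : Set ℝ) (u g : ℝ → ℝ) : Prop where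
  weakDeriv : HasWeakDerivOn I u g
  memLp : MemLp u 2 (gauss.restrict I)
  memLp_deriv : MemLp g 2 (gauss.restrict I)

/-- `μ` is an eigenvalue of the Neumann problem `-u'' + x u' = μ u` on `(a, b)`, that is,
`-(φ u')' = μ φ u` for the Gaussian density `φ`, with `u'(a) = u'(b) = 0`, in its weak
formulation in `H¹((a, b), γ)`: the Neumann condition is the natural one. -/
def IsNeumannEigenvalue (a b : EReal) (μ : ℝ) : Prop :=
  ∃ u u' : ℝ → ℝ, IsSobolev (interval a b) u u' ∧
    ¬ (u =ᵐ[gauss.restrict (interval a b)] 0) ∧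
    ∀ v v' : ℝ → ℝ, IsSobolev (interval a b) v v' →
      ∫ x in interval a b, u' x * v' x ∂gauss = μ * ∫ x in interval a b, u x * v x ∂gauss

/-- The nontrivial Neumann eigenvalues of `(a, b)`: the trivial one is `0`, with the constants as
eigenfunctions. -/
def nontrivialEigenvalues (a b : EReal) : Set ℝ := {μ : ℝ | μ ≠ 0 ∧ IsNeumannEigenvalue a b μ}

/-- The first nontrivial Neumann eigenvalue of `(a, b)`. -/
def mu1 (a b : EReal) : ℝ := sInf (nontrivialEigenvalues a b)

end

end GaussNeumann

/-! Write `φ` for the Gaussian density and `Φ` for the distribution function. Integrating `-(φ u')'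
= μ φ u` once, with the Neumann condition at the left end, gives `u' = -μ K u`, where `K u (x) =
φ(x)⁻¹ ∫_a^x u dγ`. On functions of mean zero, `K` is minus the adjoint of weak differentiation, so
the first nontrivial eigenvalue is `‖K‖⁻²`. This is `isLeast_nontrivialEigenvalues`. It needs the
norm of `K` to be attained, which follows from a weighted Hardy inequality that controls the tails
on unbounded intervals (`exists_norm_hardyOp_eq`).

The substitution `t = Φ(x) - Φ(a)` turns every interval of measure `L` into `(0, L)` with Lebesgue
measure. Only the shift `s = Φ(a)` survives: `1 / μ₁` is the maximum over mean-zero `U` of `∫ w(s +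
t) (∫_0^t U)² dt / ∫ U²`, where `w = 1 / I²` and `I = φ ∘ Φ⁻¹` is the isoperimetric profile
(`isHardyConst`). This dual quotient is preferred to the Rayleigh quotient of `u` because `w` is
strictly convex on `(0, 1)` (`weight_strictConvexOn`), whereas the weight `I²` of the Rayleigh
quotient is not concave.

A maximum of functionals convex in `s` is convex, and strictly so because the maximum is attained
(`IsHardyConst.lt_combo`). The reflection `t ↦ L - t` and the symmetry of `w` about `1/2` give
invariance under `s ↦ 1 - L - s`. Hence `1 / μ₁` is strictly decreasing up to the midpoint `s = (1 -
L) / 2`, which is the symmetric interval, and strictly increasing after it. Every assertion about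
`a` is read off from `s = Φ(a)`. -/

namespace GaussNeumann

/-! ### The Gaussian density -/

/-- The density of the standard Gaussian measure. -/
noncomputable def dens (x : ℝ) : ℝ := gaussianPDFReal 0 1 x

theorem dens_pos (x : ℝ) : 0 < dens x := gaussianPDFReal_pos 0 1 x one_ne_zero

theorem dens_ne_zero (x : ℝ) : dens x ≠ 0 := (dens_pos x).ne'

theorem dens_eq (x : ℝ) : dens x = (Real.sqrt (2 * Real.pi))⁻¹ * Real.exp (-x ^ 2 / 2) := by
  simp [dens, gaussianPDFReal_def]

theorem dens_neg (x : ℝ) : dens (-x) = dens x := by simp [dens_eq]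

theorem hasDerivAt_dens (x : ℝ) : HasDerivAt dens (-x * dens x) x := by
  have h : HasDerivAt (fun y : ℝ => (Real.sqrt (2 * Real.pi))⁻¹ * Real.exp (-y ^ 2 / 2))
      ((Real.sqrt (2 * Real.pi))⁻¹ * (Real.exp (-x ^ 2 / 2) * (-(2 * x) / 2))) x := by
    have h1 : HasDerivAt (fun y : ℝ => -y ^ 2 / 2) (-(2 * x) / 2) x := by
      simpa using ((hasDerivAt_pow 2 x).neg.div_const 2)
    exact (h1.exp).const_mul _
  have e : dens = fun y : ℝ => (Real.sqrt (2 * Real.pi))⁻¹ * Real.exp (-y ^ 2 / 2) :=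
    funext dens_eq
  rw [e]
  convert h using 1
  ring

theorem contDiff_dens : ContDiff ℝ ∞ dens := by
  have e : dens = fun y : ℝ => (Real.sqrt (2 * Real.pi))⁻¹ * Real.exp (-y ^ 2 / 2) :=
    funext dens_eq
  rw [e]
  fun_prop

theorem continuous_dens : Continuous dens := contDiff_dens.continuous

theorem measurable_dens : Measurable dens := continuous_dens.measurable

theorem gauss_eq : gauss = volume.withDensity (fun x => ENNReal.ofReal (dens x)) := by
  rw [gauss, gaussianReal_of_var_ne_zero 0 one_ne_zero]
  rfl

instance : IsProbabilityMeasure gauss := by unfold gauss; infer_instance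

theorem gauss_restrict_eq {J : Set ℝ} (hJ : MeasurableSet J) :
    gauss.restrict J = (volume.restrict J).withDensity (fun x => ENNReal.ofReal (dens x)) := by
  rw [gauss_eq, restrict_withDensity hJ]

theorem setLIntegral_gauss {J : Set ℝ} (hJ : MeasurableSet J) (f : ℝ → ENNReal) :
    ∫⁻ x in J, f x ∂gauss = ∫⁻ x in J, ENNReal.ofReal (dens x) * f x := by
  rw [gauss_restrict_eq hJ, lintegral_withDensity_eq_lintegral_mul_non_measurable₀ _
    (by have := measurable_dens; fun_prop) (by simp)]
  rfl

theorem setIntegral_gauss {J : Set ℝ} (hJ : MeasurableSet J) (f : ℝ → ℝ) :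
    ∫ x in J, f x ∂gauss = ∫ x in J, dens x * f x := by
  rw [gauss_restrict_eq hJ, integral_withDensity_eq_integral_toReal_smul
    (by have := measurable_dens; fun_prop) (by simp)]
  simp [ENNReal.toReal_ofReal (dens_pos _).le]

theorem ae_gauss_restrict_iff {J : Set ℝ} (hJ : MeasurableSet J) {p : ℝ → Prop} :
    (∀ᵐ x ∂gauss.restrict J, p x) ↔ ∀ᵐ x ∂volume.restrict J, p x := by
  rw [gauss_restrict_eq hJ, ae_withDensity_iff (by have := measurable_dens; fun_prop)]
  simp [dens_pos]

/-- On a compact set the density has a positive minimum, so Lebesgue measure there is at most a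
multiple of the finite measure `gauss`, for which `L²` lies in `L¹`. -/
theorem locallyIntegrableOn_of_memLp {J : Set ℝ} (hJ : IsOpen J) {f : ℝ → ℝ}
    (hf : MemLp f 2 (gauss.restrict J)) : LocallyIntegrableOn f J volume := by
  rw [locallyIntegrableOn_iff hJ.isLocallyClosed]
  intro k hk hkc
  have h1 : IntegrableOn f k gauss :=
    (show IntegrableOn f J gauss from hf.integrable (by norm_num)).mono_set hk
  rcases k.eq_empty_or_nonempty with rfl | hne
  · simp
  obtain ⟨x, -, hx⟩ := hkc.exists_isMinOn hne continuous_dens.continuousOn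
  have h2 : volume.restrict k ≤ (ENNReal.ofReal (dens x))⁻¹ • gauss.restrict k := by
    rw [Measure.le_iff]
    intro s hs
    have h3 : ENNReal.ofReal (dens x) * volume.restrict k s ≤ gauss.restrict k s := by
      rw [Measure.restrict_apply hs, Measure.restrict_apply hs, gauss_eq,
        withDensity_apply _ (hs.inter hkc.measurableSet), ← setLIntegral_const]
      refine setLIntegral_mono' (hs.inter hkc.measurableSet) fun y hy => ?_
      exact ENNReal.ofReal_le_ofReal (hx hy.2)
    have h0 : ENNReal.ofReal (dens x) ≠ 0 := by simp [dens_pos]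
    rw [Measure.smul_apply, smul_eq_mul]
    calc volume.restrict k s
        = (ENNReal.ofReal (dens x))⁻¹ * (ENNReal.ofReal (dens x) * volume.restrict k s) := by
          rw [← mul_assoc, ENNReal.inv_mul_cancel h0 ENNReal.ofReal_ne_top, one_mul]
      _ ≤ _ := by gcongr
  refine Integrable.mono_measure (Integrable.smul_measure h1 ?_) h2
  simp [dens_pos]

/-! ### Test functions -/

/-- Smooth functions with compact support in `J`. -/
structure IsTest (J : Set ℝ) (ψ : ℝ → ℝ) : Prop where
  contDiff : ContDiff ℝ ∞ ψ
  hasCompactSupport : HasCompactSupport ψ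
  tsupport_subset : tsupport ψ ⊆ J

namespace IsTest

variable {J : Set ℝ} {ψ χ : ℝ → ℝ}

theorem differentiable (h : IsTest J ψ) : Differentiable ℝ ψ :=
  h.contDiff.differentiable (by simp)

theorem hasDerivAt (h : IsTest J ψ) (x : ℝ) : HasDerivAt ψ (deriv ψ x) x :=
  (h.differentiable x).hasDerivAt

theorem continuous (h : IsTest J ψ) : Continuous ψ := h.contDiff.continuous

theorem eq_zero (h : IsTest J ψ) {x : ℝ} (hx : x ∉ J) : ψ x = 0 :=
  image_eq_zero_of_notMem_tsupport fun hx' => hx (h.tsupport_subset hx')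

theorem deriv (h : IsTest J ψ) : IsTest J (deriv ψ) where
  contDiff := (contDiff_infty_iff_deriv.1 h.contDiff).2
  hasCompactSupport := h.hasCompactSupport.deriv
  tsupport_subset := tsupport_deriv_subset.trans h.tsupport_subset

theorem add (h : IsTest J ψ) (h' : IsTest J χ) : IsTest J (fun x => ψ x + χ x) where
  contDiff := h.contDiff.add h'.contDiff
  hasCompactSupport := h.hasCompactSupport.add h'.hasCompactSupport
  tsupport_subset := (tsupport_add ψ χ).trans
    (union_subset h.tsupport_subset h'.tsupport_subset)

theorem mul_left {g : ℝ → ℝ} (h : IsTest J ψ) (hg : ContDiff ℝ ∞ g) :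
    IsTest J (fun x => g x * ψ x) where
  contDiff := hg.mul h.contDiff
  hasCompactSupport := h.hasCompactSupport.mul_left
  tsupport_subset := (tsupport_mul_subset_right).trans h.tsupport_subset

theorem const_mul (h : IsTest J ψ) (c : ℝ) : IsTest J (fun x => c * ψ x) :=
  h.mul_left contDiff_const

theorem div_dens (h : IsTest J ψ) : IsTest J (fun x => ψ x / dens x) := by
  have := h.mul_left (contDiff_dens.inv dens_ne_zero)
  simpa only [div_eq_inv_mul, Pi.inv_apply] using this

theorem memLp (h : IsTest J ψ) (K : Set ℝ) : MemLp ψ 2 (gauss.restrict K) :=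
  h.continuous.memLp_of_hasCompactSupport h.hasCompactSupport

theorem integrable (h : IsTest J ψ) : Integrable ψ :=
  h.continuous.integrable_of_hasCompactSupport h.hasCompactSupport

theorem setIntegral_eq (h : IsTest J ψ) (g : ℝ → ℝ) :
    ∫ x in J, g x * ψ x = ∫ x, g x * ψ x :=
  setIntegral_eq_integral_of_forall_compl_eq_zero fun x hx => by simp [h.eq_zero hx]

theorem integral_deriv (h : IsTest J ψ) : ∫ x, _root_.deriv ψ x = 0 :=
  integral_eq_zero_of_hasDerivAt_of_integrable h.hasDerivAt h.deriv.integrable h.integrable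

/-- A test function of mean zero is the derivative of a test function. -/
theorem exists_deriv_eq [J.OrdConnected] (h : IsTest J ψ) (h0 : ∫ x, ψ x = 0) :
    ∃ χ, IsTest J χ ∧ _root_.deriv χ = ψ := by
  rcases (tsupport ψ).eq_empty_or_nonempty with he | hne
  · have hψ : ψ = 0 := by rwa [tsupport_eq_empty_iff] at he
    refine ⟨0, ⟨contDiff_const, HasCompactSupport.zero, by simp⟩, ?_⟩
    rw [hψ]
    ext x
    simp
  have hc : IsCompact (tsupport ψ) := h.hasCompactSupport
  obtain ⟨m, hm, hm'⟩ := hc.exists_isLeast hne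
  obtain ⟨M, hM, hM'⟩ := hc.exists_isGreatest hne
  have hz : ∀ x, x ∉ Icc m M → ψ x = 0 := fun x hx =>
    image_eq_zero_of_notMem_tsupport fun hx' => hx ⟨hm' hx', hM' hx'⟩
  have hd : ∀ x, HasDerivAt (fun y => ∫ t in m..y, ψ t) (ψ x) x := fun x =>
    h.continuous.integral_hasStrictDerivAt m x |>.hasDerivAt
  have hder : _root_.deriv (fun y => ∫ t in m..y, ψ t) = ψ := funext fun x => (hd x).deriv
  have hmM : m ≤ M := hm' hM
  -- The zero mean is what makes the primitive vanish again to the right of the support.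
  have htot : ∫ t in m..M, ψ t = 0 := by
    rw [intervalIntegral.integral_of_le hmM, ← integral_Icc_eq_integral_Ioc,
      setIntegral_eq_integral_of_forall_compl_eq_zero hz, h0]
  have hsupp : Function.support (fun y => ∫ t in m..y, ψ t) ⊆ Icc m M := by
    intro x hx
    by_contra hx'
    apply hx
    rcases lt_or_ge x m with hxm | hxm
    · show ∫ t in m..x, ψ t = 0
      rw [intervalIntegral.integral_symm, intervalIntegral.integral_of_le hxm.le,
        ← integral_Icc_eq_integral_Ioc, integral_Icc_eq_integral_Ico,
        setIntegral_eq_zero_of_forall_eq_zero, neg_zero]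
      intro t ht
      exact hz t fun h => absurd h.1 (not_le.2 ht.2)
    · have hxM : M < x := by
        by_contra hh
        exact hx' ⟨hxm, not_lt.1 hh⟩
      show ∫ t in m..x, ψ t = 0
      rw [← intervalIntegral.integral_add_adjacent_intervals
        (h.continuous.intervalIntegrable m M) (h.continuous.intervalIntegrable M x), htot, zero_add,
        intervalIntegral.integral_of_le hxM.le]
      refine setIntegral_eq_zero_of_forall_eq_zero fun t ht => hz t fun h => ?_
      exact absurd h.2 (not_le.2 ht.1)
  have hts : tsupport (fun y => ∫ t in m..y, ψ t) ⊆ Icc m M :=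
    closure_minimal hsupp isClosed_Icc
  refine ⟨fun y => ∫ t in m..y, ψ t, ⟨?_, ?_, ?_⟩, hder⟩
  · rw [contDiff_infty_iff_deriv, hder]
    exact ⟨fun x => (hd x).differentiableAt, h.contDiff⟩
  · exact HasCompactSupport.of_support_subset_isCompact isCompact_Icc hsupp
  · exact hts.trans (OrdConnected.out ‹_› (h.tsupport_subset hm) (h.tsupport_subset hM))

end IsTest

theorem exists_isTest_pos {J : Set ℝ} (hJ : IsOpen J) (hne : J.Nonempty) :
    ∃ ψ, IsTest J ψ ∧ ∫ x, ψ x = 1 := by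
  obtain ⟨c, hc⟩ := hne
  obtain ⟨f, hf1, hf2, hf3, hf4, hf5⟩ :=
    exists_contDiff_tsupport_subset (n := ⊤) (hJ.mem_nhds hc)
  have hf : IsTest J f := ⟨hf3, hf2, hf1⟩
  have hpos : 0 < ∫ x, f x := by
    refine Continuous.integral_pos_of_hasCompactSupport_nonneg_nonzero hf.continuous hf2
      (fun x => (hf4 ⟨x, rfl⟩).1) (x := c) (by simp [hf5])
  refine ⟨_, hf.const_mul (∫ x, f x)⁻¹, ?_⟩
  rw [integral_const_mul, inv_mul_cancel₀ hpos.ne']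

/-- The lemma of du Bois-Reymond. -/
theorem exists_ae_eq_const {J : Set ℝ} [J.OrdConnected] (hJ : IsOpen J) (hne : J.Nonempty)
    {f : ℝ → ℝ} (hf : LocallyIntegrableOn f J volume)
    (h : ∀ ψ, IsTest J ψ → ∫ x in J, f x * deriv ψ x = 0) :
    ∃ c, ∀ᵐ x ∂volume.restrict J, f x = c := by
  obtain ⟨η, hη, hη1⟩ := exists_isTest_pos hJ hne
  have hint : ∀ ψ, IsTest J ψ → Integrable (fun x => f x * ψ x) := by
    intro ψ hψ
    have h1 : IntegrableOn f (tsupport ψ) :=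
      (locallyIntegrableOn_iff hJ.isLocallyClosed).1 hf _ hψ.tsupport_subset hψ.hasCompactSupport
    have h2 : IntegrableOn (fun x => f x * ψ x) (tsupport ψ) :=
      h1.mul_continuousOn hψ.continuous.continuousOn hψ.hasCompactSupport
    refine (integrableOn_iff_integrable_of_support_subset ?_).1 h2
    intro x hx
    refine subset_tsupport ψ fun h0 => hx ?_
    simp [h0]
  refine ⟨∫ x, f x * η x, ?_⟩
  have key := hJ.ae_eq_zero_of_integral_contDiff_smul_eq_zero (μ := volume)
    (f := fun x => f x - ∫ x, f x * η x)
    (hf.sub (continuous_const.locallyIntegrable.locallyIntegrableOn J)) ?_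
  · rw [ae_restrict_iff' hJ.measurableSet]
    filter_upwards [key] with x hx hxJ
    linarith [hx hxJ]
  · intro θ hθ1 hθ2 hθ3
    have hθ : IsTest J θ := ⟨hθ1, hθ2, hθ3⟩
    -- Subtracting the right multiple of the unit-mass bump `η` gives mean zero, hence the
    -- derivative of an admissible test function.
    have hω : IsTest J (fun x => θ x + (-∫ x, θ x) * η x) := hθ.add (hη.const_mul _)
    obtain ⟨χ, hχ, hχd⟩ := hω.exists_deriv_eq (by
      rw [integral_add hθ.integrable (hη.integrable.const_mul _), integral_const_mul, hη1]
      ring)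
    have h1 := h χ hχ
    rw [hχ.deriv.setIntegral_eq, hχd] at h1
    have h2 : ∫ x, f x * (θ x + (-∫ x, θ x) * η x)
        = (∫ x, f x * θ x) + (-∫ x, θ x) * ∫ x, f x * η x := by
      rw [← integral_const_mul, ← integral_add (hint θ hθ) ((hint η hη).const_mul _)]
      congr 1; ext x; ring
    rw [h2] at h1
    simp only [smul_eq_mul, mul_sub]
    rw [integral_sub, integral_mul_const]
    · have : ∫ x, θ x * f x = ∫ x, f x * θ x := by simp only [mul_comm]
      rw [this]; linarith
    · simpa only [mul_comm] using hint θ hθ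
    · exact hθ.integrable.mul_const _

/-! ### The Hardy operator of a Gaussian interval -/

instance fact_two_ne_top : Fact ((2 : ENNReal) ≠ ⊤) := ⟨by simp⟩

/-- The space `L²(J, γ)`. -/
noncomputable abbrev L2Space (J : Set ℝ) := Lp ℝ 2 (gauss.restrict J)

theorem inner_eq_integral {α : Type*} [MeasurableSpace α] {μ : Measure α} (f g : Lp ℝ 2 μ) :
    inner ℝ f g = ∫ x, f x * g x ∂μ := by
  rw [L2.inner_def]
  refine integral_congr_ae (Filter.Eventually.of_forall fun x => ?_)
  simp [mul_comm]

theorem inner_toLp {α : Type*} [MeasurableSpace α] {μ : Measure α} {f g : α → ℝ}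
    (hf : MemLp f 2 μ) (hg : MemLp g 2 μ) :
    inner ℝ (hf.toLp f) (hg.toLp g) = ∫ x, f x * g x ∂μ := by
  rw [inner_eq_integral]
  refine integral_congr_ae ?_
  filter_upwards [hf.coeFn_toLp, hg.coeFn_toLp] with x h1 h2
  rw [h1, h2]

theorem norm_sq_eq_integral {α : Type*} [MeasurableSpace α] {μ : Measure α} (f : Lp ℝ 2 μ) :
    ‖f‖ ^ 2 = ∫ x, f x ^ 2 ∂μ := by
  rw [← real_inner_self_eq_norm_sq, inner_eq_integral]
  simp only [sq]

theorem ofReal_norm_sq {α : Type*} [MeasurableSpace α] {μ : Measure α} (f : Lp ℝ 2 μ) :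
    ENNReal.ofReal (‖f‖ ^ 2) = ∫⁻ x, ENNReal.ofReal (f x ^ 2) ∂μ := by
  rw [norm_sq_eq_integral, ofReal_integral_eq_lintegral_ofReal]
  · exact (memLp_two_iff_integrable_sq (Lp.memLp f).1).1 (Lp.memLp f)
  · exact Filter.Eventually.of_forall fun x => sq_nonneg _

theorem memLp_two_of_lintegral_lt_top {α : Type*} [MeasurableSpace α] {μ : Measure α} {f : α → ℝ}
    (hf : AEStronglyMeasurable f μ) (h : ∫⁻ x, ENNReal.ofReal (f x ^ 2) ∂μ < ⊤) : MemLp f 2 μ := by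
  rw [memLp_two_iff_integrable_sq hf]
  refine ⟨hf.pow 2, ?_⟩
  rwa [hasFiniteIntegral_iff_ofReal (Filter.Eventually.of_forall fun x => sq_nonneg _)]

/-- The primitive `x ↦ ∫_{J ∩ (-∞, x)} u dγ`. -/
noncomputable def cumul (J : Set ℝ) (u : ℝ → ℝ) (x : ℝ) : ℝ :=
  ∫ y in Iio x, u y ∂gauss.restrict J

/-- The operator sending `u` to `-y'`, where `y` solves `-y'' + x y' = u`. -/
noncomputable def hardy (J : Set ℝ) (u : ℝ → ℝ) (x : ℝ) : ℝ := cumul J u x / dens x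

theorem cumul_congr {J : Set ℝ} {u v : ℝ → ℝ} (h : u =ᵐ[gauss.restrict J] v) :
    cumul J u = cumul J v := by
  ext x
  exact integral_congr_ae (ae_restrict_of_ae h)

theorem hardy_congr {J : Set ℝ} {u v : ℝ → ℝ} (h : u =ᵐ[gauss.restrict J] v) :
    hardy J u = hardy J v := by
  ext x
  rw [hardy, hardy, cumul_congr h]

/-- Evaluation of the primitive at a point is a bounded linear functional. Linearity, the uniform
bound, and pointwise convergence along strongly or weakly convergent sequences all rest on this. -/
theorem cumul_eq_inner {J : Set ℝ} (u : L2Space J) (x : ℝ) :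
    cumul J u x = inner ℝ (indicatorConstLp 2 (measurableSet_Iio (a := x))
      (measure_ne_top (gauss.restrict J) _) (1 : ℝ)) u :=
  (L2.inner_indicatorConstLp_one measurableSet_Iio _ u).symm

theorem abs_cumul_le {J : Set ℝ} (u : L2Space J) (x : ℝ) : |cumul J u x| ≤ ‖u‖ := by
  rw [cumul_eq_inner]
  refine (abs_real_inner_le_norm _ _).trans ?_
  refine mul_le_of_le_one_left (norm_nonneg _) ?_
  rw [norm_indicatorConstLp (by simp) (by simp), norm_one, one_mul]
  exact Real.rpow_le_one measureReal_nonneg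
    ((measureReal_mono (subset_univ _)).trans
      (by simp)) (by simp)

theorem measurable_cumul {J : Set ℝ} (u : L2Space J) : Measurable (cumul J u) := by
  have h : cumul J u = fun x => ∫ y, (if y < x then u y else 0) ∂gauss.restrict J := by
    ext x
    rw [cumul, ← integral_indicator measurableSet_Iio]
    rfl
  rw [h]
  refine StronglyMeasurable.measurable (StronglyMeasurable.integral_prod_right ?_)
  refine StronglyMeasurable.ite (measurableSet_lt measurable_snd measurable_fst) ?_
    stronglyMeasurable_const
  exact (Lp.stronglyMeasurable u).comp_measurable measurable_snd

theorem measurable_hardy {J : Set ℝ} (u : L2Space J) : Measurable (hardy J u) :=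
  (measurable_cumul u).div measurable_dens

theorem hardy_add {J : Set ℝ} (u v : L2Space J) :
    hardy J (u + v : L2Space J) = hardy J u + hardy J v := by
  ext x
  simp only [hardy, Pi.add_apply, cumul_eq_inner, inner_add_right, add_div]

theorem hardy_smul {J : Set ℝ} (c : ℝ) (u : L2Space J) :
    hardy J (c • u : L2Space J) = c • hardy J u := by
  ext x
  simp only [hardy, Pi.smul_apply, cumul_eq_inner, inner_smul_right, smul_eq_mul, mul_div_assoc]

/-! ### A weighted Hardy inequality and the boundedness of the operator -/

theorem cumul_test {J : Set ℝ} (hJ : MeasurableSet J) {ψ : ℝ → ℝ} (hψ : IsTest J ψ) (x : ℝ) :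
    cumul J (fun y => deriv ψ y / dens y) x = ψ x := by
  rw [cumul, Measure.restrict_restrict measurableSet_Iio,
    setIntegral_gauss (measurableSet_Iio.inter hJ)]
  have h1 : ∀ y, dens y * (deriv ψ y / dens y) = deriv ψ y := fun y => by
    field_simp [dens_ne_zero y]
  simp only [h1]
  rw [inter_comm, ← setIntegral_indicator measurableSet_Iio,
    setIntegral_eq_integral_of_forall_compl_eq_zero, integral_indicator measurableSet_Iio,
    ← integral_Iic_eq_integral_Iio]
  · exact HasCompactSupport.integral_Iic_deriv_eq (hψ.contDiff.of_le (by simp))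
      hψ.hasCompactSupport x
  · intro y hy
    simp only [indicator_apply, hψ.deriv.eq_zero hy, ite_self]

/-- Expand `0 ≤ ∫ (ψ' + x ψ / 2)² / φ`. Since `φ' = -x φ`, the cross term `x ψ ψ' / φ` equals `½ (x
ψ² / φ)' - ½ (1 + x²) ψ² / φ`, and the exact derivative integrates to zero. The growth of the weight
at infinity later supplies compactness. -/
theorem integral_weight_test_le {ψ : ℝ → ℝ} {J : Set ℝ} (hψ : IsTest J ψ) :
    ∫ x, (x ^ 2 / 4 + 1 / 2) * (ψ x ^ 2 / dens x) ≤ ∫ x, deriv ψ x ^ 2 / dens x := by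
  have hψd : IsTest J (fun x => ψ x / dens x) := hψ.div_dens
  have h' : IsTest J (fun x => x * ψ x * (ψ x / dens x)) :=
    hψd.mul_left (contDiff_id.mul hψ.contDiff)
  have hA : IsTest J (fun x => deriv ψ x * (deriv ψ x / dens x)) :=
    hψ.deriv.div_dens.mul_left hψ.deriv.contDiff
  have hB : IsTest J (fun x => (x ^ 2 / 4 + 1 / 2) * ψ x * (ψ x / dens x)) :=
    hψd.mul_left (by have := hψ.contDiff; fun_prop)
  have hpos : ∀ x, 0 ≤ (deriv ψ x + x / 2 * ψ x) ^ 2 / dens x := fun x =>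
    div_nonneg (sq_nonneg _) (dens_pos x).le
  have hderiv : ∀ x, deriv (fun x => x * ψ x * (ψ x / dens x)) x
      = (2 * x * ψ x * deriv ψ x + (1 + x ^ 2) * ψ x ^ 2) / dens x := by
    intro x
    have := (((hasDerivAt_id x).mul (hψ.hasDerivAt x)).mul
      ((hψ.hasDerivAt x).div (hasDerivAt_dens x) (dens_ne_zero x))).deriv
    have h2 := dens_ne_zero x
    refine this.trans ?_
    simp only [Pi.mul_apply, Pi.div_apply, id]
    field_simp
    ring
  have key : ∀ x, deriv ψ x * (deriv ψ x / dens x) - (x ^ 2 / 4 + 1 / 2) * ψ x * (ψ x / dens x)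
      = (deriv ψ x + x / 2 * ψ x) ^ 2 / dens x
        - 1 / 2 * deriv (fun x => x * ψ x * (ψ x / dens x)) x := by
    intro x
    rw [hderiv]
    have h2 := dens_ne_zero x
    field_simp
    ring
  have hle : 0 ≤ ∫ x, (deriv ψ x * (deriv ψ x / dens x)
      - (x ^ 2 / 4 + 1 / 2) * ψ x * (ψ x / dens x)) := by
    have hi : ∫ x, ((deriv ψ x * (deriv ψ x / dens x)
      - (x ^ 2 / 4 + 1 / 2) * ψ x * (ψ x / dens x))
        + 1 / 2 * deriv (fun x => x * ψ x * (ψ x / dens x)) x)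
      = ∫ x, (deriv ψ x * (deriv ψ x / dens x)
      - (x ^ 2 / 4 + 1 / 2) * ψ x * (ψ x / dens x)) := by
      have hs : Integrable (fun x => deriv ψ x * (deriv ψ x / dens x)
          - (x ^ 2 / 4 + 1 / 2) * ψ x * (ψ x / dens x)) := hA.integrable.sub hB.integrable
      rw [integral_add hs (h'.deriv.integrable.const_mul _),
        integral_const_mul, h'.integral_deriv, mul_zero, add_zero]
    rw [← hi]
    refine integral_nonneg fun x => ?_
    simp only [key]
    simpa using hpos x
  rw [integral_sub hA.integrable hB.integrable] at hle
  have e1 : ∀ x, (x ^ 2 / 4 + 1 / 2) * (ψ x ^ 2 / dens x)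
    = (x ^ 2 / 4 + 1 / 2) * ψ x * (ψ x / dens x) := fun x => by ring
  have e2 : ∀ x, deriv ψ x ^ 2 / dens x = deriv ψ x * (deriv ψ x / dens x) := fun x => by ring
  simp only [e1, e2]
  linarith

/-- The space of the functions `ψ' / φ`, with test functions `ψ` on `J`. -/
noncomputable def testSpace (J : Set ℝ) : Submodule ℝ (L2Space J) where
  carrier := {e | ∃ ψ, IsTest J ψ ∧ e =ᵐ[gauss.restrict J] fun x => deriv ψ x / dens x}
  add_mem' := by
    rintro e f ⟨ψ, hψ, h1⟩ ⟨χ, hχ, h2⟩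
    refine ⟨_, hψ.add hχ, ?_⟩
    filter_upwards [h1, h2, Lp.coeFn_add e f] with x h1 h2 h3
    rw [h3, Pi.add_apply, h1, h2, ((hψ.hasDerivAt x).fun_add (hχ.hasDerivAt x)).deriv, add_div]
  zero_mem' := by
    refine ⟨fun _ => 0, ⟨contDiff_const, HasCompactSupport.zero, ?_⟩, ?_⟩
    · simp [tsupport]
    · filter_upwards [Lp.coeFn_zero ℝ 2 (gauss.restrict J)] with x h
      exact h.trans (by simp)
  smul_mem' := by
    rintro c e ⟨ψ, hψ, h1⟩
    refine ⟨_, hψ.const_mul c, ?_⟩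
    filter_upwards [h1, Lp.coeFn_smul c e] with x h1 h3
    rw [h3, Pi.smul_apply, h1, ((hψ.hasDerivAt x).const_mul c).deriv, smul_eq_mul, mul_div_assoc]

/-- The element `ψ' / φ` of `L²(J, γ)`. -/
noncomputable def testElem {J : Set ℝ} {ψ : ℝ → ℝ} (hψ : IsTest J ψ) : L2Space J :=
  (hψ.deriv.div_dens.memLp J).toLp _

theorem testElem_mem {J : Set ℝ} {ψ : ℝ → ℝ} (hψ : IsTest J ψ) : testElem hψ ∈ testSpace J :=
  ⟨ψ, hψ, MemLp.coeFn_toLp _⟩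

/-- The closure of the test space, consisting of the functions with mean zero. -/
noncomputable def meanZero (J : Set ℝ) : Submodule ℝ (L2Space J) := (testSpace J).topologicalClosure

theorem exists_seq_of_mem_meanZero {J : Set ℝ} {u : L2Space J} (hu : u ∈ meanZero J) :
    ∃ e : ℕ → L2Space J, (∀ n, e n ∈ testSpace J) ∧ Filter.Tendsto e Filter.atTop (nhds u) := by
  have : u ∈ closure (testSpace J : Set (L2Space J)) := hu
  exact mem_closure_iff_seq_limit.1 this

theorem testSpace_le_meanZero (J : Set ℝ) : testSpace J ≤ meanZero J :=
  Submodule.le_topologicalClosure _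

theorem hardy_test {J : Set ℝ} (hJ : MeasurableSet J) {ψ : ℝ → ℝ} (hψ : IsTest J ψ)
    {e : L2Space J} (he : e =ᵐ[gauss.restrict J] fun x => deriv ψ x / dens x) :
    hardy J e = fun x => ψ x / dens x := by
  ext x
  rw [hardy, cumul_congr he, cumul_test hJ hψ]

theorem integral_eq_zero_of_mem_meanZero {J : Set ℝ} (hJ : MeasurableSet J) {u : L2Space J}
    (hu : u ∈ meanZero J) : ∫ x, u x ∂gauss.restrict J = 0 := by
  have h1 : ∀ f : L2Space J, ∫ x, f x ∂gauss.restrict J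
      = inner ℝ (indicatorConstLp 2 MeasurableSet.univ
        (measure_ne_top (gauss.restrict J) _) (1 : ℝ)) f := fun f => by
    rw [L2.inner_indicatorConstLp_one, setIntegral_univ]
  obtain ⟨e, he, hlim⟩ := exists_seq_of_mem_meanZero hu
  rw [h1]
  refine tendsto_nhds_unique (Filter.Tendsto.inner tendsto_const_nhds hlim) ?_
  refine tendsto_const_nhds.congr fun n => ?_
  rw [← h1]
  obtain ⟨ψ, hψ, h2⟩ := he n
  rw [integral_congr_ae h2, setIntegral_gauss hJ]
  have h3 : ∀ y, dens y * (deriv ψ y / dens y) = 1 * deriv ψ y := fun y => by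
    field_simp [dens_ne_zero y]
  simp only [h3]
  rw [hψ.deriv.setIntegral_eq]
  simp [hψ.integral_deriv]

/-- A function orthogonal to all `ψ' / φ` has zero weak derivative, so it is constant by du
Bois-Reymond. A function of mean zero is orthogonal to constants and thus lies in the double
orthogonal complement, which is the closure. -/
theorem mem_meanZero_of_integral_eq_zero {J : Set ℝ} [J.OrdConnected] (hJ : IsOpen J)
    (hne : J.Nonempty) {u : L2Space J} (hu : ∫ x, u x ∂gauss.restrict J = 0) : u ∈ meanZero J := by
  rw [meanZero, ← Submodule.orthogonal_orthogonal_eq_closure, Submodule.mem_orthogonal]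
  intro z hz
  rw [Submodule.mem_orthogonal] at hz
  obtain ⟨c, hc⟩ := exists_ae_eq_const hJ hne (locallyIntegrableOn_of_memLp hJ (Lp.memLp z)) (by
    intro ψ hψ
    have h := hz _ (testElem_mem hψ)
    rw [inner_eq_integral, integral_congr_ae (g := fun x => deriv ψ x / dens x * z x),
      setIntegral_gauss hJ.measurableSet] at h
    · rw [← h]
      refine integral_congr_ae (Filter.Eventually.of_forall fun x => ?_)
      have := dens_ne_zero x
      field_simp
    · filter_upwards [(hψ.deriv.div_dens.memLp J).coeFn_toLp] with x hx
      rw [testElem, hx])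
  rw [← ae_gauss_restrict_iff hJ.measurableSet] at hc
  rw [inner_eq_integral, integral_congr_ae (g := fun x => c * u x), integral_const_mul, hu,
    mul_zero]
  filter_upwards [hc] with x hx
  rw [hx]

/-- For `ψ' / φ` this is the inequality for test functions. It passes to the closure by Fatou's
lemma, because the images under `hardy` converge pointwise. -/
theorem lintegral_hardy_sq_le {J : Set ℝ} (hJ : MeasurableSet J) {u : L2Space J}
    (hu : u ∈ meanZero J) :
    ∫⁻ x, ENNReal.ofReal ((x ^ 2 / 4 + 1 / 2) * hardy J u x ^ 2) ∂gauss.restrict J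
      ≤ ENNReal.ofReal (‖u‖ ^ 2) := by
  obtain ⟨e, he, hlim⟩ := exists_seq_of_mem_meanZero hu
  have hpt : ∀ x, Filter.Tendsto (fun n => hardy J (e n) x) Filter.atTop (nhds (hardy J u x)) := by
    intro x
    simp only [hardy, cumul_eq_inner]
    exact (Filter.Tendsto.inner tendsto_const_nhds hlim).div_const _
  have hbd : ∀ n, ∫⁻ x, ENNReal.ofReal ((x ^ 2 / 4 + 1 / 2) * hardy J (e n) x ^ 2)
      ∂gauss.restrict J ≤ ENNReal.ofReal (‖e n‖ ^ 2) := by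
    intro n
    obtain ⟨ψ, hψ, h2⟩ := he n
    rw [hardy_test hJ hψ h2, norm_sq_eq_integral, integral_congr_ae
      (g := fun x => (deriv ψ x / dens x) ^ 2) (by filter_upwards [h2] with x hx; rw [hx]),
      setIntegral_gauss hJ]
    have e1 : ∀ x, dens x * (deriv ψ x / dens x) ^ 2 = deriv ψ x / dens x * deriv ψ x :=
      fun x => by have := dens_ne_zero x; field_simp
    simp only [e1]
    rw [hψ.deriv.setIntegral_eq]
    have hT : IsTest J (fun x => (x ^ 2 / 4 + 1 / 2) * (ψ x / dens x) * (ψ x / dens x)) :=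
      hψ.div_dens.mul_left (by have := hψ.div_dens.contDiff; fun_prop)
    have e2 : ∀ x, (x ^ 2 / 4 + 1 / 2) * (ψ x / dens x) ^ 2
      = (x ^ 2 / 4 + 1 / 2) * (ψ x / dens x) * (ψ x / dens x) := fun x => by ring
    simp only [e2]
    rw [← ofReal_integral_eq_lintegral_ofReal]
    · apply ENNReal.ofReal_le_ofReal
      rw [setIntegral_gauss hJ]
      have hT' : IsTest J (fun x => dens x * ((x ^ 2 / 4 + 1 / 2) * (ψ x / dens x)) * (ψ x / dens x)) :=
        hψ.div_dens.mul_left (contDiff_dens.mul (by have := hψ.div_dens.contDiff; fun_prop))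
      have e3 : ∀ x, dens x * ((x ^ 2 / 4 + 1 / 2) * (ψ x / dens x) * (ψ x / dens x))
        = dens x * ((x ^ 2 / 4 + 1 / 2) * (ψ x / dens x)) * (ψ x / dens x) := fun x => by ring
      simp only [e3]
      rw [hψ.div_dens.setIntegral_eq]
      refine le_trans (le_of_eq ?_) ((integral_weight_test_le hψ).trans (le_of_eq ?_))
      · congr 1; ext x; have := dens_ne_zero x; field_simp
      · congr 1; ext x; have := dens_ne_zero x; field_simp
    · exact (hT.memLp J).integrable (by norm_num)
    · exact Filter.Eventually.of_forall fun x => by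
        have h : 0 ≤ (x ^ 2 / 4 + 1 / 2) * (ψ x / dens x) ^ 2 := by positivity
        rwa [e2] at h
  calc ∫⁻ x, ENNReal.ofReal ((x ^ 2 / 4 + 1 / 2) * hardy J u x ^ 2) ∂gauss.restrict J
      = ∫⁻ x, Filter.liminf (fun n => ENNReal.ofReal ((x ^ 2 / 4 + 1 / 2) * hardy J (e n) x ^ 2))
          Filter.atTop ∂gauss.restrict J := by
        refine lintegral_congr fun x => (Filter.Tendsto.liminf_eq ?_).symm
        exact ENNReal.tendsto_ofReal (((hpt x).pow 2).const_mul _)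
    _ ≤ Filter.liminf (fun n => ∫⁻ x, ENNReal.ofReal ((x ^ 2 / 4 + 1 / 2) * hardy J (e n) x ^ 2)
          ∂gauss.restrict J) Filter.atTop := by
        refine lintegral_liminf_le fun n => ?_
        have := measurable_hardy (e n)
        fun_prop
    _ ≤ Filter.liminf (fun n => ENNReal.ofReal (‖e n‖ ^ 2)) Filter.atTop :=
        Filter.liminf_le_liminf (Filter.Eventually.of_forall hbd)
    _ = ENNReal.ofReal (‖u‖ ^ 2) :=
        (ENNReal.tendsto_ofReal (hlim.norm.pow 2)).liminf_eq

theorem lintegral_hardy_sq_le_two_mul {J : Set ℝ} (hJ : MeasurableSet J) {u : L2Space J}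
    (hu : u ∈ meanZero J) :
    ∫⁻ x, ENNReal.ofReal (hardy J u x ^ 2) ∂gauss.restrict J ≤ ENNReal.ofReal (2 * ‖u‖ ^ 2) := by
  calc ∫⁻ x, ENNReal.ofReal (hardy J u x ^ 2) ∂gauss.restrict J
      ≤ ∫⁻ x, ENNReal.ofReal 2 * ENNReal.ofReal ((x ^ 2 / 4 + 1 / 2) * hardy J u x ^ 2)
          ∂gauss.restrict J := by
        refine lintegral_mono fun x => ?_
        rw [← ENNReal.ofReal_mul (by norm_num)]
        apply ENNReal.ofReal_le_ofReal
        nlinarith [mul_nonneg (sq_nonneg x) (sq_nonneg (hardy J u x))]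
    _ = ENNReal.ofReal 2 * ∫⁻ x, ENNReal.ofReal ((x ^ 2 / 4 + 1 / 2) * hardy J u x ^ 2)
          ∂gauss.restrict J := lintegral_const_mul' _ _ (by simp)
    _ ≤ ENNReal.ofReal 2 * ENNReal.ofReal (‖u‖ ^ 2) := by gcongr; exact lintegral_hardy_sq_le hJ hu
    _ = _ := by rw [← ENNReal.ofReal_mul (by norm_num)]

theorem memLp_hardy {J : Set ℝ} (hJ : MeasurableSet J) {u : L2Space J} (hu : u ∈ meanZero J) :
    MemLp (hardy J u) 2 (gauss.restrict J) :=
  memLp_two_of_lintegral_lt_top (measurable_hardy u).aestronglyMeasurable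
    ((lintegral_hardy_sq_le_two_mul hJ hu).trans_lt ENNReal.ofReal_lt_top)

/-- The Hardy operator on the functions with mean zero. -/
noncomputable def hardyOp {J : Set ℝ} (hJ : MeasurableSet J) : meanZero J →L[ℝ] L2Space J :=
  LinearMap.mkContinuous
    { toFun := fun u => (memLp_hardy hJ u.2).toLp _
      map_add' := fun u v => by
        rw [← MemLp.toLp_add]
        exact MemLp.toLp_congr _ _ (Filter.EventuallyEq.of_eq (hardy_add _ _))
      map_smul' := fun c u => by
        rw [RingHom.id_apply, ← MemLp.toLp_const_smul]
        exact MemLp.toLp_congr _ _ (Filter.EventuallyEq.of_eq (hardy_smul _ _)) }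
    -- The squared bound `2 ‖u‖²` is relaxed to `(2 ‖u‖)²`; any finite constant would do.
    2 (fun u => by
      refine abs_le_of_sq_le_sq' ?_ (by positivity) |>.2
      have h := lintegral_hardy_sq_le_two_mul hJ u.2
      have h2 := ofReal_norm_sq ((memLp_hardy hJ u.2).toLp _)
      rw [lintegral_congr_ae (g := fun x => ENNReal.ofReal (hardy J u x ^ 2)) (by
        filter_upwards [(memLp_hardy hJ u.2).coeFn_toLp] with x hx
        rw [hx])] at h2
      rw [← h2, ENNReal.ofReal_le_ofReal_iff (by positivity)] at h
      refine h.trans ?_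
      rw [mul_pow, Submodule.coe_norm]
      nlinarith [sq_nonneg ‖(u : L2Space J)‖])

theorem coeFn_hardyOp {J : Set ℝ} (hJ : MeasurableSet J) (u : meanZero J) :
    hardyOp hJ u =ᵐ[gauss.restrict J] hardy J u :=
  (memLp_hardy hJ u.2).coeFn_toLp

theorem ofReal_norm_hardyOp_sq {J : Set ℝ} (hJ : MeasurableSet J) (u : meanZero J) :
    ENNReal.ofReal (‖hardyOp hJ u‖ ^ 2)
      = ∫⁻ x, ENNReal.ofReal (hardy J u x ^ 2) ∂gauss.restrict J := by
  rw [ofReal_norm_sq]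
  refine lintegral_congr_ae ?_
  filter_upwards [coeFn_hardyOp hJ u] with x hx
  rw [hx]

/-! ### Maximizers of compact operators -/

section Hilbert

variable {M F : Type*} [NormedAddCommGroup M] [InnerProductSpace ℝ M] [CompleteSpace M]
  [NormedAddCommGroup F] [InnerProductSpace ℝ F] [CompleteSpace F]

/-- Weak sequential compactness of the unit ball of a separable Hilbert space. -/
theorem exists_weak_limit [TopologicalSpace.SeparableSpace M] (u : ℕ → M) (hu : ∀ n, ‖u n‖ ≤ 1) :
    ∃ w : M, ‖w‖ ≤ 1 ∧ ∃ k : ℕ → ℕ, StrictMono k ∧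
      ∀ l : StrongDual ℝ M, Filter.Tendsto (fun n => l (u (k n))) Filter.atTop (nhds (l w)) := by
  -- The Riesz isometry moves the sequence to the dual, where sequential Banach–Alaoglu applies.
  have hc := WeakDual.isSeqCompact_closedBall ℝ M (0 : StrongDual ℝ M) 1
  obtain ⟨a, ha, k, hk, hlim⟩ := hc
    (x := fun n => StrongDual.toWeakDual (InnerProductSpace.toDual ℝ M (u n))) (fun n => by
      show InnerProductSpace.toDual ℝ M (u n) ∈ Metric.closedBall 0 1
      rw [mem_closedBall_zero_iff, LinearIsometryEquiv.norm_map]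
      exact hu n)
  have ha' : ‖WeakDual.toStrongDual a‖ ≤ 1 := by
    have : WeakDual.toStrongDual a ∈ Metric.closedBall 0 1 := ha
    rwa [mem_closedBall_zero_iff] at this
  refine ⟨(InnerProductSpace.toDual ℝ M).symm (WeakDual.toStrongDual a), ?_, k, hk, fun l => ?_⟩
  · rwa [LinearIsometryEquiv.norm_map]
  · have h1 := (WeakBilin.tendsto_iff_forall_eval_tendsto _ ContinuousLinearMap.coe_injective).1 hlim
      ((InnerProductSpace.toDual ℝ M).symm l)
    have h2 : ∀ v : M, l v = inner ℝ v ((InnerProductSpace.toDual ℝ M).symm l) := fun v => by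
      rw [real_inner_comm, InnerProductSpace.toDual_symm_apply]
    rw [h2, InnerProductSpace.toDual_symm_apply]
    simp only [h2]
    exact h1

/-- This is the Euler–Lagrange equation `T*T u = ‖T‖² u` of a maximizer. Expanding `‖T*T u - ‖T‖²
u‖²` and using `‖T*T u‖ ≤ ‖T‖ ‖T u‖` shows that it is nonpositive, with no differentiation. -/
theorem inner_map_map_of_norm_eq (T : M →L[ℝ] F) {u : M} (hu : ‖T u‖ = ‖T‖ * ‖u‖) (z : M) :
    inner ℝ (T u) (T z) = ‖T‖ ^ 2 * inner ℝ u z := by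
  have h0 : ContinuousLinearMap.adjoint T (T u) - ‖T‖ ^ 2 • u = 0 := by
    have h1 : ‖ContinuousLinearMap.adjoint T (T u) - ‖T‖ ^ 2 • u‖ ^ 2 ≤ 0 := by
      have h3 : ‖ContinuousLinearMap.adjoint T (T u)‖ ≤ ‖T‖ * ‖T u‖ := by
        simpa using (ContinuousLinearMap.adjoint T).le_opNorm (T u)
      have h4 := pow_le_pow_left₀ (norm_nonneg _) h3 2
      rw [norm_sub_sq_real, inner_smul_right, ContinuousLinearMap.adjoint_inner_left,
        real_inner_self_eq_norm_sq, norm_smul, Real.norm_of_nonneg (sq_nonneg _)]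
      rw [hu] at h4 ⊢
      nlinarith
    exact norm_eq_zero.1 (pow_eq_zero_iff two_ne_zero |>.1 (le_antisymm h1 (sq_nonneg _)))
  rw [← ContinuousLinearMap.adjoint_inner_left, sub_eq_zero.1 h0, inner_smul_left]
  simp

end Hilbert

/-! ### Attainment of the norm of the Hardy operator -/

instance {J : Set ℝ} : CompleteSpace (meanZero J) :=
  (Submodule.isClosed_topologicalClosure (testSpace J)).completeSpace_coe

theorem hardyOp_ne_zero {J : Set ℝ} (hJ : IsOpen J) (hne : J.Nonempty) :
    hardyOp hJ.measurableSet ≠ 0 := by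
  intro h0
  obtain ⟨ψ, hψ, h1⟩ := exists_isTest_pos hJ hne
  have h2 := coeFn_hardyOp hJ.measurableSet ⟨testElem hψ, testSpace_le_meanZero J (testElem_mem hψ)⟩
  rw [h0, hardy_test hJ.measurableSet hψ (e := testElem hψ) (MemLp.coeFn_toLp _)] at h2
  have h3 : ∀ᵐ x ∂gauss.restrict J, ψ x = 0 := by
    filter_upwards [h2, Lp.coeFn_zero ℝ 2 (gauss.restrict J)] with x hx hx0
    have : ψ x / dens x = 0 := hx.symm.trans (by simpa using hx0)
    simpa [dens_ne_zero] using this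
  rw [ae_gauss_restrict_iff hJ.measurableSet] at h3
  have h4 := hψ.setIntegral_eq (fun _ => 1)
  simp only [one_mul] at h4
  rw [integral_congr_ae (g := fun _ => (0 : ℝ)) h3, h1] at h4
  simp at h4

theorem norm_hardyOp_pos {J : Set ℝ} (hJ : IsOpen J) (hne : J.Nonempty) :
    0 < ‖hardyOp hJ.measurableSet‖ := by
  refine lt_of_le_of_ne (norm_nonneg (hardyOp hJ.measurableSet)) fun h =>
    hardyOp_ne_zero hJ hne ?_
  ext1 u
  have h1 := (hardyOp hJ.measurableSet).le_opNorm u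
  rw [← h, zero_mul] at h1
  exact norm_le_zero_iff.1 h1

/-- The tails of the image of the Hardy operator are uniformly small. -/
theorem ofReal_norm_hardyOp_sq_le {J : Set ℝ} (hJ : MeasurableSet J) (u : meanZero J)
    (hu : ‖u‖ ≤ 1) {R : ℝ} (hR : 0 < R) :
    ENNReal.ofReal (‖hardyOp hJ u‖ ^ 2)
      ≤ ∫⁻ x in Icc (-R) R, ENNReal.ofReal (hardy J u x ^ 2) ∂gauss.restrict J
        + ENNReal.ofReal (4 / R ^ 2) := by
  rw [ofReal_norm_hardyOp_sq, ← lintegral_add_compl _ (measurableSet_Icc (a := -R) (b := R))]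
  gcongr
  calc ∫⁻ x in (Icc (-R) R)ᶜ, ENNReal.ofReal (hardy J u x ^ 2) ∂gauss.restrict J
      ≤ ∫⁻ x in (Icc (-R) R)ᶜ, ENNReal.ofReal (4 / R ^ 2) *
          ENNReal.ofReal ((x ^ 2 / 4 + 1 / 2) * hardy J u x ^ 2) ∂gauss.restrict J := by
        refine setLIntegral_mono' measurableSet_Icc.compl fun x hx => ?_
        rw [← ENNReal.ofReal_mul (by positivity)]
        apply ENNReal.ofReal_le_ofReal
        -- Outside `[-R, R]` the Hardy weight is at least `R² / 4`, whence the factor `4 / R²`.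
        have hx2 : R ^ 2 ≤ x ^ 2 := by
          have : ¬ |x| ≤ R := fun h => hx (abs_le.1 h)
          rw [← sq_abs x]
          exact pow_le_pow_left₀ hR.le (not_le.1 this).le 2
        rw [← mul_assoc]
        refine le_mul_of_one_le_left (sq_nonneg _) ?_
        rw [div_mul_eq_mul_div, le_div_iff₀ (by positivity)]
        linarith
    _ ≤ ∫⁻ x, ENNReal.ofReal (4 / R ^ 2) *
          ENNReal.ofReal ((x ^ 2 / 4 + 1 / 2) * hardy J u x ^ 2) ∂gauss.restrict J :=
        setLIntegral_le_lintegral _ _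
    _ = ENNReal.ofReal (4 / R ^ 2) * ∫⁻ x,
          ENNReal.ofReal ((x ^ 2 / 4 + 1 / 2) * hardy J u x ^ 2) ∂gauss.restrict J :=
        lintegral_const_mul' _ _ (by simp)
    _ ≤ ENNReal.ofReal (4 / R ^ 2) * ENNReal.ofReal (‖(u : L2Space J)‖ ^ 2) := by
        gcongr
        exact lintegral_hardy_sq_le hJ u.2
    _ ≤ ENNReal.ofReal (4 / R ^ 2) * 1 := by
        gcongr
        rw [ENNReal.ofReal_le_one]
        exact pow_le_one₀ (norm_nonneg _) hu
    _ = _ := mul_one _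

/-- The norm of the Hardy operator is attained. -/
theorem exists_norm_hardyOp_eq {J : Set ℝ} (hJ : IsOpen J) (hne : J.Nonempty) :
    ∃ u : meanZero J, u ≠ 0 ∧ ‖hardyOp hJ.measurableSet u‖ = ‖hardyOp hJ.measurableSet‖ * ‖u‖ := by
  set K := hardyOp hJ.measurableSet with hK
  have hKpos : 0 < ‖K‖ := norm_hardyOp_pos hJ hne
  have hex : ∀ n : ℕ, ∃ u : meanZero J, ‖u‖ < 1 ∧ ‖K‖ - 1 / ((n : ℝ) + 1) < ‖K u‖ := fun n =>
    K.exists_lt_apply_of_lt_opNorm (sub_lt_self _ (by positivity))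
  choose v hv1 hv2 using hex
  obtain ⟨w, hw1, k, hk, hlim⟩ := exists_weak_limit v fun n => (hv1 n).le
  -- Weak convergence suffices for pointwise convergence of the images, since each value is a
  -- continuous functional.
  have hpt : ∀ x, Filter.Tendsto (fun n => hardy J (v (k n)) x) Filter.atTop
      (nhds (hardy J w x)) := by
    intro x
    simp only [hardy, cumul_eq_inner]
    exact (hlim ((innerSL ℝ (indicatorConstLp 2 (measurableSet_Iio (a := x))
      (measure_ne_top (gauss.restrict J) _) (1 : ℝ))).comp (meanZero J).subtypeL)).div_const _
  have hnorm : Filter.Tendsto (fun n => ‖K (v (k n))‖) Filter.atTop (nhds ‖K‖) := by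
    have h1 : Filter.Tendsto (fun n : ℕ => ‖K‖ - 1 / ((n : ℝ) + 1)) Filter.atTop (nhds (‖K‖ - 0)) :=
      tendsto_const_nhds.sub tendsto_one_div_add_atTop_nhds_zero_nat
    rw [sub_zero] at h1
    refine tendsto_of_tendsto_of_tendsto_of_le_of_le (h1.comp hk.tendsto_atTop) tendsto_const_nhds
      (fun n => (hv2 (k n)).le) fun n => ?_
    exact (K.le_opNorm _).trans (mul_le_of_le_one_right hKpos.le (hv1 _).le)
  have hR : ∀ R : ℝ, 0 < R → ‖K‖ ^ 2 ≤ ‖K w‖ ^ 2 + 4 / R ^ 2 := by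
    intro R hR
    obtain ⟨y, -, hy⟩ := (isCompact_Icc (a := -R) (b := R)).exists_isMinOn
      ⟨0, by constructor <;> linarith⟩ continuous_dens.continuousOn
    have hdom : Filter.Tendsto (fun n => ∫⁻ x in Icc (-R) R,
        ENNReal.ofReal (hardy J (v (k n)) x ^ 2) ∂gauss.restrict J) Filter.atTop
        (nhds (∫⁻ x in Icc (-R) R, ENNReal.ofReal (hardy J w x ^ 2) ∂gauss.restrict J)) := by
      -- On `[-R, R]` the primitives are bounded by `1` and the density by its minimum `dens y`,
      -- which gives a constant majorant.
      refine tendsto_lintegral_of_dominated_convergence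
        (fun _ => ENNReal.ofReal ((1 / dens y) ^ 2)) (fun n => ?_) (fun n => ?_) ?_ ?_
      · have := measurable_hardy (v (k n)).1
        fun_prop
      · refine (ae_restrict_iff' measurableSet_Icc).2 (Filter.Eventually.of_forall fun x hx => ?_)
        refine ENNReal.ofReal_le_ofReal (sq_le_sq' ?_ ?_ |>.trans le_rfl) <;>
        · have h1 : |hardy J (v (k n)) x| ≤ 1 / dens y := by
            rw [hardy, abs_div, abs_of_pos (dens_pos x)]
            exact div_le_div₀ zero_le_one
              ((abs_cumul_le _ x).trans (hv1 (k n)).le) (dens_pos y) (hy hx)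
          linarith [abs_le.1 h1]
      · simp only [lintegral_const]
        exact ENNReal.mul_ne_top ENNReal.ofReal_ne_top (measure_ne_top _ _)
      · exact Filter.Eventually.of_forall fun x => ENNReal.tendsto_ofReal ((hpt x).pow 2)
    have h3 : ENNReal.ofReal (‖K‖ ^ 2) ≤ ENNReal.ofReal (‖K w‖ ^ 2) + ENNReal.ofReal (4 / R ^ 2) := by
      refine le_trans (le_of_tendsto_of_tendsto' (ENNReal.tendsto_ofReal (hnorm.pow 2))
        (hdom.add_const (ENNReal.ofReal (4 / R ^ 2))) fun n =>
          ofReal_norm_hardyOp_sq_le hJ.measurableSet _ (hv1 _).le hR) ?_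
      rw [ofReal_norm_hardyOp_sq]
      exact add_le_add (setLIntegral_le_lintegral _ _) le_rfl
    rwa [← ENNReal.ofReal_add (by positivity) (by positivity),
      ENNReal.ofReal_le_ofReal_iff (by positivity)] at h3
  -- No mass escapes to infinity: let `R → ∞`.
  have hle : ‖K‖ ^ 2 ≤ ‖K w‖ ^ 2 := by
    have h1 : Filter.Tendsto (fun R : ℝ => ‖K w‖ ^ 2 + 4 / R ^ 2) Filter.atTop
        (nhds (‖K w‖ ^ 2 + 0)) :=
      tendsto_const_nhds.add ((Filter.tendsto_pow_atTop two_ne_zero).const_div_atTop 4)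
    rw [add_zero] at h1
    exact ge_of_tendsto h1 (Filter.eventually_atTop.2 ⟨1, fun R h => hR R (by linarith)⟩)
  have hle' : ‖K‖ ≤ ‖K w‖ := le_of_sq_le_sq hle (norm_nonneg _)
  have hop := K.le_opNorm w
  refine ⟨w, ?_, le_antisymm hop ((mul_le_of_le_one_right hKpos.le hw1).trans hle')⟩
  rintro rfl
  rw [map_zero, norm_zero] at hle'
  exact absurd hKpos (not_lt.2 hle')

/-! ### The Neumann eigenvalues -/

/-- For `ψ' / φ` this is the definition of the weak derivative; the general case follows by density
and continuity. No boundary condition on `v` is needed, which is how the natural Neumann condition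
enters. -/
theorem inner_hardyOp_sobolev {J : Set ℝ} (hJ : MeasurableSet J) (u : meanZero J) {v v' : ℝ → ℝ}
    (h : IsSobolev J v v') :
    inner ℝ (hardyOp hJ u) (h.memLp_deriv.toLp v')
      = - inner ℝ (u : L2Space J) (h.memLp.toLp v) := by
  obtain ⟨e, he, hlim⟩ := exists_seq_of_mem_meanZero u.2
  have hlim' : Filter.Tendsto (fun n => (⟨e n, testSpace_le_meanZero J (he n)⟩ : meanZero J))
      Filter.atTop (nhds u) := tendsto_subtype_rng.2 hlim
  refine tendsto_nhds_unique (Filter.Tendsto.inner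
    (((hardyOp hJ).continuous.tendsto u).comp hlim') tendsto_const_nhds) ?_
  refine Filter.Tendsto.congr (fun n => ?_) (Filter.Tendsto.inner hlim tendsto_const_nhds).neg
  obtain ⟨ψ, hψ, h2⟩ := he n
  have h3 := h.weakDeriv.integral_eq ψ hψ.contDiff hψ.hasCompactSupport hψ.tsupport_subset
  have h4 := coeFn_hardyOp hJ ⟨e n, testSpace_le_meanZero J (he n)⟩
  rw [hardy_test hJ hψ h2] at h4
  rw [Function.comp_apply, inner_eq_integral, inner_eq_integral,
    integral_congr_ae (g := fun x => deriv ψ x / dens x * v x),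
    integral_congr_ae (f := fun x => hardyOp hJ _ x * _) (g := fun x => ψ x / dens x * v' x),
    setIntegral_gauss hJ, setIntegral_gauss hJ]
  · have e1 : ∀ x, dens x * (deriv ψ x / dens x * v x) = v x * deriv ψ x := fun x => by
      have := dens_ne_zero x
      field_simp
    have e2 : ∀ x, dens x * (ψ x / dens x * v' x) = v' x * ψ x := fun x => by
      have := dens_ne_zero x
      field_simp
    simp only [e1, e2, h3, neg_neg]
  · filter_upwards [h4, h.memLp_deriv.coeFn_toLp] with x h1 h2
    rw [h1, h2]
  · filter_upwards [h2, h.memLp.coeFn_toLp] with x h1 h2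
    rw [h1, h2]

theorem isSobolev_const (J : Set ℝ) :
    IsSobolev J (fun _ => 1) (fun _ => 0) where
  weakDeriv :=
    { locInt := (continuous_const.locallyIntegrable).locallyIntegrableOn J
      locInt_deriv := (continuous_const.locallyIntegrable).locallyIntegrableOn J
      integral_eq := fun ψ h1 h2 h3 => by
        have hψ : IsTest J ψ := ⟨h1, h2, h3⟩
        rw [hψ.deriv.setIntegral_eq]
        simp [hψ.integral_deriv] }
  memLp := memLp_const 1
  memLp_deriv := memLp_const 0

/-- The maximizers of the Hardy operator are weakly differentiable. -/
theorem isSobolev_of_maximizer {J : Set ℝ} (hJ : IsOpen J) {u : meanZero J}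
    (hu : ‖hardyOp hJ.measurableSet u‖ = ‖hardyOp hJ.measurableSet‖ * ‖u‖)
    (hpos : 0 < ‖hardyOp hJ.measurableSet‖) :
    IsSobolev J u
      (((-(‖hardyOp hJ.measurableSet‖ ^ 2)⁻¹) • hardyOp hJ.measurableSet u : L2Space J)) where
  weakDeriv :=
    { locInt := locallyIntegrableOn_of_memLp hJ (Lp.memLp _)
      locInt_deriv := locallyIntegrableOn_of_memLp hJ (Lp.memLp _)
      integral_eq := fun ψ h1 h2 h3 => by
        have hψ : IsTest J ψ := ⟨h1, h2, h3⟩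
        -- Tested against `ψ' / φ`, the Euler–Lagrange equation reads `∫ (K u) ψ = ‖K‖² ∫ u ψ'`, so
        -- the weak derivative is `-‖K‖⁻² K u`.
        have hEL := inner_map_map_of_norm_eq _ hu
          ⟨testElem hψ, testSpace_le_meanZero J (testElem_mem hψ)⟩
        have h4 := coeFn_hardyOp hJ.measurableSet
          ⟨testElem hψ, testSpace_le_meanZero J (testElem_mem hψ)⟩
        rw [hardy_test hJ.measurableSet hψ (e := testElem hψ) (MemLp.coeFn_toLp _)] at h4
        rw [Submodule.coe_inner, inner_eq_integral, inner_eq_integral,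
          integral_congr_ae (g := fun x => hardyOp hJ.measurableSet u x * (ψ x / dens x))
            (by filter_upwards [h4] with x hx; rw [hx]),
          integral_congr_ae (f := fun x => (u : L2Space J) x * _)
            (g := fun x => (u : L2Space J) x * (deriv ψ x / dens x))
            (by
              filter_upwards [(hψ.deriv.div_dens.memLp J).coeFn_toLp] with x hx
              rw [testElem, hx]),
          setIntegral_gauss hJ.measurableSet, setIntegral_gauss hJ.measurableSet] at hEL
        have e1 : ∀ x, dens x * (hardyOp hJ.measurableSet u x * (ψ x / dens x))
            = hardyOp hJ.measurableSet u x * ψ x := fun x => by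
          have := dens_ne_zero x
          field_simp
        have e2 : ∀ x, dens x * ((u : L2Space J) x * (deriv ψ x / dens x))
            = (u : L2Space J) x * deriv ψ x := fun x => by
          have := dens_ne_zero x
          field_simp
        simp only [e1, e2] at hEL
        rw [integral_congr_ae (f := fun x => _ * ψ x)
          (g := fun x => -(‖hardyOp hJ.measurableSet‖ ^ 2)⁻¹ * (hardyOp hJ.measurableSet u x * ψ x)),
          integral_const_mul, hEL]
        · field_simp
        · have h5 := Lp.coeFn_smul (-(‖hardyOp hJ.measurableSet‖ ^ 2)⁻¹) (hardyOp hJ.measurableSet u)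
          rw [Filter.EventuallyEq, ae_gauss_restrict_iff hJ.measurableSet] at h5
          filter_upwards [h5] with x hx
          rw [hx, Pi.smul_apply, smul_eq_mul, mul_assoc] }
  memLp := Lp.memLp _
  memLp_deriv := Lp.memLp _

theorem interval_ordConnected (a b : EReal) : (interval a b).OrdConnected :=
  ⟨fun _ hx _ hy _ hz => ⟨hx.1.trans_le (EReal.coe_le_coe_iff.2 hz.1),
    (EReal.coe_le_coe_iff.2 hz.2).trans_lt hy.2⟩⟩

theorem isOpen_interval (a b : EReal) : IsOpen (interval a b) :=
  isOpen_Ioo.preimage continuous_coe_real_ereal (t := Ioo a b)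

/-- The first nontrivial eigenvalue is the inverse square of the norm of the Hardy operator. -/
theorem isLeast_nontrivialEigenvalues {a b : EReal} (hne : (interval a b).Nonempty) :
    IsLeast (nontrivialEigenvalues a b)
      (‖hardyOp (isOpen_interval a b).measurableSet‖ ^ 2)⁻¹ := by
  have hJ := isOpen_interval a b
  have hoc := interval_ordConnected a b
  have hpos : 0 < ‖hardyOp hJ.measurableSet‖ := norm_hardyOp_pos hJ hne
  constructor
  · refine ⟨by positivity, ?_⟩
    obtain ⟨u, hu0, hu⟩ := exists_norm_hardyOp_eq hJ hne
    have hs := isSobolev_of_maximizer hJ hu hpos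
    refine ⟨_, _, hs, ?_, fun v v' hv => ?_⟩
    · intro h0
      apply hu0
      ext1
      rw [Lp.ext_iff]
      exact h0.trans (Lp.coeFn_zero _ _ _).symm
    · have h1 := inner_hardyOp_sobolev hJ.measurableSet u hv
      have h2 : ∫ x in interval a b, (-(‖hardyOp hJ.measurableSet‖ ^ 2)⁻¹ •
          hardyOp hJ.measurableSet u : L2Space (interval a b)) x * v' x ∂gauss
          = inner ℝ (-(‖hardyOp hJ.measurableSet‖ ^ 2)⁻¹ • hardyOp hJ.measurableSet u)
            (hv.memLp_deriv.toLp v') := by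
        rw [inner_eq_integral]
        refine integral_congr_ae ?_
        filter_upwards [hv.memLp_deriv.coeFn_toLp] with x hx
        rw [hx]
      have h3 : ∫ x in interval a b, (u : L2Space (interval a b)) x * v x ∂gauss
          = inner ℝ (u : L2Space (interval a b)) (hv.memLp.toLp v) := by
        rw [inner_eq_integral]
        refine integral_congr_ae ?_
        filter_upwards [hv.memLp.coeFn_toLp] with x hx
        rw [hx]
      rw [h2, h3, inner_smul_left, h1]
      simp
  · rintro μ ⟨hμ0, u, u', hu, hu0, heq⟩
    -- Testing with a constant forces mean zero, because `μ ≠ 0`; testing with `u` itself gives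
    -- `‖u'‖² = μ ‖u‖²`.
    have h1 := heq _ _ (isSobolev_const _)
    have h2 := heq u u' hu
    have hmean : ∫ x in interval a b, u x ∂gauss = 0 := by
      simpa [hμ0] using h1
    have hmem : hu.memLp.toLp u ∈ meanZero (interval a b) := by
      refine mem_meanZero_of_integral_eq_zero hJ hne ?_
      rw [integral_congr_ae hu.memLp.coeFn_toLp, hmean]
    have h3 := inner_hardyOp_sobolev hJ.measurableSet ⟨_, hmem⟩ hu
    rw [← inner_toLp hu.memLp_deriv hu.memLp_deriv, ← inner_toLp hu.memLp hu.memLp,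
      real_inner_self_eq_norm_sq, real_inner_self_eq_norm_sq] at h2
    rw [real_inner_self_eq_norm_sq] at h3
    have hn : 0 < ‖hu.memLp.toLp u‖ := by
      rw [norm_pos_iff]
      intro h
      exact hu0 (hu.memLp.coeFn_toLp.symm.trans (by rw [h]; exact Lp.coeFn_zero _ _ _))
    -- Cauchy–Schwarz in `⟨K u, u'⟩ = -‖u‖²` yields `‖u‖ ≤ ‖K‖ ‖u'‖`, hence `1 ≤ ‖K‖² μ`.
    have h4 := (abs_real_inner_le_norm (hardyOp hJ.measurableSet ⟨_, hmem⟩)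
      (hu.memLp_deriv.toLp u'))
    have h5 : ‖hardyOp hJ.measurableSet ⟨_, hmem⟩‖
        ≤ ‖hardyOp hJ.measurableSet‖ * ‖hu.memLp.toLp u‖ :=
      (hardyOp hJ.measurableSet).le_opNorm _
    rw [h3, abs_neg, abs_of_nonneg (sq_nonneg _)] at h4
    set n := ‖hu.memLp.toLp u‖
    set n' := ‖hu.memLp_deriv.toLp u'‖
    set κ := ‖hardyOp hJ.measurableSet‖
    have hn' : 0 ≤ n' := norm_nonneg _
    have h6 : n ≤ κ * n' := by
      have : n * n ≤ n * (κ * n') := by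
        calc n * n = n ^ 2 := by ring
          _ ≤ _ := h4
          _ ≤ κ * n * n' := by gcongr
          _ = _ := by ring
      exact le_of_mul_le_mul_left this hn
    have h7 : n ^ 2 ≤ κ ^ 2 * (μ * n ^ 2) := by
      rw [← h2, ← mul_pow]
      gcongr
    rw [inv_le_iff_one_le_mul₀' (by positivity)]
    have : 1 * n ^ 2 ≤ (κ ^ 2 * μ) * n ^ 2 := by linarith
    exact le_of_mul_le_mul_right this (by positivity)

/-! ### The Gaussian distribution function -/

theorem hasDerivAt_erf (x : ℝ) :
    HasDerivAt erf (2 / Real.sqrt Real.pi * Real.exp (-x ^ 2)) x := by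
  have hc : Continuous fun t : ℝ => Real.exp (-t ^ 2) := by fun_prop
  exact ((hc.integral_hasStrictDerivAt 0 x).hasDerivAt).const_mul _

theorem erf_strictMono : StrictMono erf := by
  refine strictMono_of_deriv_pos fun x => ?_
  rw [(hasDerivAt_erf x).deriv]
  have := Real.pi_pos
  positivity

theorem erf_neg (x : ℝ) : erf (-x) = -erf x := by
  have h := intervalIntegral.integral_comp_neg (a := 0) (b := x) fun t : ℝ => Real.exp (-t ^ 2)
  simp only [even_two.neg_pow, neg_zero] at h
  rw [erf, erf, intervalIntegral.integral_symm, ← h, mul_neg]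

theorem continuous_erf : Continuous erf :=
  continuous_iff_continuousAt.2 fun x => (hasDerivAt_erf x).continuousAt

theorem tendsto_erf_atTop : Filter.Tendsto erf Filter.atTop (nhds 1) := by
  have h1 : IntegrableOn (fun t : ℝ => Real.exp (-t ^ 2)) (Ioi 0) := by
    simpa using (integrable_exp_neg_mul_sq one_pos).integrableOn (s := Ioi 0)
  have h2 := (intervalIntegral_tendsto_integral_Ioi 0 h1 Filter.tendsto_id).const_mul
    (2 / Real.sqrt Real.pi)
  have h3 := integral_gaussian_Ioi 1
  simp only [neg_mul, one_mul, div_one] at h3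
  rw [h3] at h2
  have h4 : Real.sqrt Real.pi ≠ 0 := (Real.sqrt_pos.2 Real.pi_pos).ne'
  have h5 : 2 / Real.sqrt Real.pi * (Real.sqrt Real.pi / 2) = 1 := by field_simp
  rwa [h5] at h2

theorem tendsto_erf_atBot : Filter.Tendsto erf Filter.atBot (nhds (-1)) := by
  have h := (tendsto_erf_atTop.comp Filter.tendsto_neg_atBot_atTop).neg
  refine h.congr fun x => ?_
  rw [Function.comp_apply, erf_neg, neg_neg]

theorem erf_lt_one (x : ℝ) : erf x < 1 :=
  (erf_strictMono (lt_add_one x)).trans_le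
    (erf_strictMono.monotone.ge_of_tendsto tendsto_erf_atTop _)

theorem neg_one_lt_erf (x : ℝ) : -1 < erf x := by
  have := erf_lt_one (-x)
  rw [erf_neg] at this
  linarith

theorem exists_erf_eq {y : ℝ} (hy : y ∈ Ioo (-1 : ℝ) 1) : ∃ x, erf x = y := by
  obtain ⟨a, ha⟩ := (tendsto_erf_atBot.eventually (gt_mem_nhds hy.1)).exists
  obtain ⟨b, hb⟩ := (tendsto_erf_atTop.eventually (lt_mem_nhds hy.2)).exists
  obtain ⟨x, hx⟩ := mem_range_of_exists_le_of_exists_ge continuous_erf ⟨a, ha.le⟩ ⟨b, hb.le⟩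
  exact ⟨x, hx⟩

theorem erfE_coe (x : ℝ) : erfE (x : EReal) = erf x := rfl

theorem erfE_bot : erfE ⊥ = -1 := rfl

theorem erfE_top : erfE ⊤ = 1 := rfl

theorem erfE_neg (a : EReal) : erfE (-a) = -erfE a := by
  induction a using EReal.rec with
  | bot => rw [EReal.neg_bot, erfE_bot, erfE_top, neg_neg]
  | coe x => rw [← EReal.coe_neg, erfE_coe, erfE_coe, erf_neg]
  | top => rw [EReal.neg_top, erfE_bot, erfE_top]

theorem erfE_erfInv {y : ℝ} (hy : y ∈ Icc (-1 : ℝ) 1) : erfE (erfInv y) = y := by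
  refine Function.invFun_eq ?_
  rcases eq_or_lt_of_le hy.1 with h | h
  · exact ⟨⊥, h⟩
  rcases eq_or_lt_of_le hy.2 with h' | h'
  · exact ⟨⊤, h'.symm⟩
  obtain ⟨x, hx⟩ := exists_erf_eq ⟨h, h'⟩
  exact ⟨x, hx⟩

/-- The Gaussian distribution function on the extended real line. -/
noncomputable def cdfE (a : EReal) : ℝ := (1 + erfE (((Real.sqrt 2 / 2 : ℝ) : EReal) * a)) / 2

/-- The Gaussian distribution function. -/
noncomputable def cdfR (x : ℝ) : ℝ := (1 + erf (Real.sqrt 2 / 2 * x)) / 2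

theorem sqrt_two_div_two_pos : 0 < Real.sqrt 2 / 2 := by positivity

theorem cdfE_coe (x : ℝ) : cdfE x = cdfR x := by
  rw [cdfE, ← EReal.coe_mul, erfE_coe, cdfR]

theorem cdfE_bot : cdfE ⊥ = 0 := by
  rw [cdfE, EReal.coe_mul_bot_of_pos sqrt_two_div_two_pos, erfE_bot]
  norm_num

theorem cdfE_top : cdfE ⊤ = 1 := by
  rw [cdfE, EReal.coe_mul_top_of_pos sqrt_two_div_two_pos, erfE_top]
  norm_num

theorem cdfE_neg (a : EReal) : cdfE (-a) = 1 - cdfE a := by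
  rw [cdfE, mul_neg, erfE_neg, cdfE]
  ring

theorem cdfR_strictMono : StrictMono cdfR := by
  intro x y h
  have := erf_strictMono (mul_lt_mul_of_pos_left h sqrt_two_div_two_pos)
  simp only [cdfR]
  linarith

theorem cdfR_mem (x : ℝ) : cdfR x ∈ Ioo (0 : ℝ) 1 := by
  have h1 := erf_lt_one (Real.sqrt 2 / 2 * x)
  have h2 := neg_one_lt_erf (Real.sqrt 2 / 2 * x)
  constructor <;> simp only [cdfR] <;> linarith

theorem cdfE_strictMono : StrictMono cdfE := by
  intro a b hab
  induction a using EReal.rec with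
  | bot =>
    induction b using EReal.rec with
    | bot => simp at hab
    | coe y => rw [cdfE_bot, cdfE_coe]; exact (cdfR_mem y).1
    | top => rw [cdfE_bot, cdfE_top]; norm_num
  | coe x =>
    induction b using EReal.rec with
    | bot => simp at hab
    | coe y => rw [cdfE_coe, cdfE_coe]; exact cdfR_strictMono (EReal.coe_lt_coe_iff.1 hab)
    | top => rw [cdfE_coe, cdfE_top]; exact (cdfR_mem x).2
  | top => simp at hab

theorem cdfE_mem (a : EReal) : cdfE a ∈ Icc (0 : ℝ) 1 := by
  rw [← cdfE_bot, ← cdfE_top]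
  exact ⟨cdfE_strictMono.monotone bot_le, cdfE_strictMono.monotone le_top⟩

/-- Endpoints given through the inverse error function become Gaussian masses. As `cdfE` is strictly
monotone, comparing endpoints reduces to arithmetic of masses. -/
theorem cdfE_sqrtTwoErfInv {y : ℝ} (hy : y ∈ Icc (-1 : ℝ) 1) :
    cdfE (sqrtTwoErfInv y) = (1 + y) / 2 := by
  have h : ((Real.sqrt 2 / 2 : ℝ) : EReal) * ((Real.sqrt 2 : ℝ) : EReal) = 1 := by
    rw [← EReal.coe_mul, ← EReal.coe_one]
    congr 1
    have := Real.mul_self_sqrt (show (0 : ℝ) ≤ 2 by norm_num)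
    linarith
  rw [cdfE, sqrtTwoErfInv, ← mul_assoc, h, one_mul, erfE_erfInv hy]

theorem hasDerivAt_cdfR (x : ℝ) : HasDerivAt cdfR (dens x) x := by
  have h1 : HasDerivAt (fun y => erf (Real.sqrt 2 / 2 * y))
      (2 / Real.sqrt Real.pi * Real.exp (-(Real.sqrt 2 / 2 * x) ^ 2) * (Real.sqrt 2 / 2)) x := by
    have := (hasDerivAt_erf (Real.sqrt 2 / 2 * x)).comp x
      ((hasDerivAt_id x).const_mul (Real.sqrt 2 / 2))
    simpa [Function.comp_def] using this
  refine ((h1.const_add 1).div_const 2).congr_deriv ?_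
  have h2 : (Real.sqrt 2 / 2 * x) ^ 2 = x ^ 2 / 2 := by
    rw [mul_pow, div_pow, Real.sq_sqrt (by norm_num)]
    ring
  have h3 : Real.sqrt 2 * Real.sqrt 2 = 2 := Real.mul_self_sqrt (by norm_num)
  have h4 : Real.sqrt Real.pi ≠ 0 := (Real.sqrt_pos.2 Real.pi_pos).ne'
  rw [dens_eq, h2, Real.sqrt_mul (by norm_num), neg_div]
  field_simp
  linarith

theorem continuous_cdfR : Continuous cdfR :=
  continuous_iff_continuousAt.2 fun x => (hasDerivAt_cdfR x).continuousAt

theorem exists_cdfR_eq {s : ℝ} (hs : s ∈ Ioo (0 : ℝ) 1) : ∃ x, cdfR x = s := by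
  obtain ⟨x, hx⟩ := exists_erf_eq (y := 2 * s - 1) ⟨by linarith [hs.1], by linarith [hs.2]⟩
  refine ⟨(Real.sqrt 2 / 2)⁻¹ * x, ?_⟩
  rw [cdfR, mul_inv_cancel_left₀ sqrt_two_div_two_pos.ne', hx]
  ring

theorem exists_cdfE_eq {s : ℝ} (hs : s ∈ Icc (0 : ℝ) 1) : ∃ a, cdfE a = s := by
  refine ⟨sqrtTwoErfInv (2 * s - 1), ?_⟩
  rw [cdfE_sqrtTwoErfInv ⟨by linarith [hs.1], by linarith [hs.2]⟩]
  ring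

theorem tendsto_cdfR_atBot : Filter.Tendsto cdfR Filter.atBot (nhds 0) := by
  have h := tendsto_erf_atBot.comp (Filter.tendsto_id.const_mul_atBot sqrt_two_div_two_pos)
  have h2 := (h.const_add 1).div_const 2
  rw [show ((1 : ℝ) + -1) / 2 = 0 by norm_num] at h2
  exact h2

theorem gauss_Iic (x : ℝ) : gauss (Iic x) = ENNReal.ofReal (cdfR x) := by
  rw [gauss_eq, withDensity_apply _ measurableSet_Iic, ← ofReal_integral_eq_lintegral_ofReal]
  · congr 1
    rw [integral_Iic_of_hasDerivAt_of_tendsto' (fun y _ => hasDerivAt_cdfR y) _ tendsto_cdfR_atBot,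
      sub_zero]
    exact (integrable_gaussianPDFReal 0 1).integrableOn
  · exact (integrable_gaussianPDFReal 0 1).integrableOn
  · exact Filter.Eventually.of_forall fun y => (dens_pos y).le

theorem gauss_setOf_le (a : EReal) : gauss {x : ℝ | (x : EReal) ≤ a} = ENNReal.ofReal (cdfE a) := by
  induction a using EReal.rec with
  | bot => simp [cdfE_bot]
  | coe x =>
    rw [cdfE_coe, ← gauss_Iic]
    congr 1
    ext y
    simp
  | top => simp [cdfE_top]

theorem gauss_setOf_lt (a : EReal) : gauss {x : ℝ | (x : EReal) < a} = ENNReal.ofReal (cdfE a) := by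
  induction a using EReal.rec with
  | bot => simp [cdfE_bot]
  | coe x =>
    have : NullSingletonClass gauss := by
      unfold gauss
      exact nullSingletonClass_gaussianReal one_ne_zero
    rw [cdfE_coe, ← gauss_Iic, ← measure_congr Iio_ae_eq_Iic]
    congr 1
    ext y
    simp
  | top => simp [cdfE_top, EReal.coe_lt_top]

theorem gauss_interval (a b : EReal) (hab : a ≤ b) :
    gauss (interval a b) = ENNReal.ofReal (cdfE b - cdfE a) := by
  rcases hab.eq_or_lt with rfl | hlt
  · have : interval a a = ∅ := by
      ext x
      simp only [interval, mem_ofPred_eq, mem_empty_iff_false, iff_false, not_and, not_lt]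
      exact fun h => h.le
    simp [this]
  have h : interval a b = {x : ℝ | (x : EReal) < b} \ {x : ℝ | (x : EReal) ≤ a} := by
    ext x
    simp [interval, and_comm]
  rw [h, measure_sdiff, gauss_setOf_le, gauss_setOf_lt, ENNReal.ofReal_sub _ (cdfE_mem a).1]
  · exact fun x hx => lt_of_le_of_lt hx hlt
  · exact (measurableSet_Iic.preimage measurable_coe_real_ereal).nullMeasurableSet
  · exact measure_ne_top _ _

theorem interval_nonempty {a b : EReal} (hab : a < b) : (interval a b).Nonempty := by
  obtain ⟨x, h1, h2⟩ := EReal.lt_iff_exists_real_btwn.1 hab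
  exact ⟨x, h1, h2⟩

/-- The Gaussian quantile function. -/
noncomputable def quantile : ℝ → ℝ := Function.invFun cdfR

theorem quantile_cdfR (x : ℝ) : quantile (cdfR x) = x :=
  Function.leftInverse_invFun cdfR_strictMono.injective x

theorem cdfR_quantile {s : ℝ} (hs : s ∈ Ioo (0 : ℝ) 1) : cdfR (quantile s) = s :=
  Function.invFun_eq (exists_cdfR_eq hs)

/-- The inverse square of the Gaussian isoperimetric profile. -/
noncomputable def weight (s : ℝ) : ℝ := 1 / dens (quantile s) ^ 2

theorem weight_cdfR (x : ℝ) : weight (cdfR x) = 1 / dens x ^ 2 := by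
  rw [weight, quantile_cdfR]

theorem cdfR_neg (x : ℝ) : cdfR (-x) = 1 - cdfR x := by
  rw [← cdfE_coe, EReal.coe_neg, cdfE_neg, cdfE_coe]

theorem weight_one_sub {s : ℝ} (hs : s ∈ Ioo (0 : ℝ) 1) : weight (1 - s) = weight s := by
  obtain ⟨x, rfl⟩ := exists_cdfR_eq hs
  rw [← cdfR_neg, weight_cdfR, weight_cdfR, dens_neg]

theorem weight_pos (s : ℝ) : 0 < weight s := by
  have := dens_pos (quantile s)
  unfold weight
  positivity

theorem hasDerivAt_weight {s : ℝ} (hs : s ∈ Ioo (0 : ℝ) 1) :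
    HasDerivAt weight (2 * quantile s / dens (quantile s) ^ 3) s := by
  have hcont : ContinuousAt quantile s := by
    have hmono : StrictMonoOn quantile (Ioo 0 1) := by
      intro s hs t ht hst
      rw [← cdfR_strictMono.lt_iff_lt, cdfR_quantile hs, cdfR_quantile ht]
      exact hst
    -- A monotone function whose image is the whole line has no jumps.
    refine hmono.continuousAt_of_image_mem_nhds (isOpen_Ioo.mem_nhds hs) ?_
    have : quantile '' Ioo 0 1 = univ :=
      eq_univ_of_forall fun x => ⟨cdfR x, cdfR_mem x, quantile_cdfR x⟩
    rw [this]
    exact Filter.univ_mem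
  have h1 : HasDerivAt quantile (dens (quantile s))⁻¹ s :=
    HasDerivAt.of_local_left_inverse hcont (hasDerivAt_cdfR _) (dens_ne_zero _)
      (by filter_upwards [isOpen_Ioo.mem_nhds hs] with t ht using cdfR_quantile ht)
  have h2 := (((hasDerivAt_dens (quantile s)).comp s h1).pow 2).inv
    (pow_ne_zero 2 (dens_ne_zero (quantile s)))
  have h3 : weight = ((dens ∘ quantile) ^ 2)⁻¹ := by
    ext t
    simp [weight]
  rw [h3]
  refine h2.congr_deriv ?_
  have := dens_ne_zero (quantile s)
  simp only [Function.comp_apply, Pi.pow_apply]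
  field_simp
  push_cast
  ring

/-- At `s = Φ(x)` the derivative of the weight is `2 x / φ(x)³`, and `d/dx` of this is `(2 + 6 x²) /
φ(x)³ > 0`, while `x` increases with `s`. -/
theorem weight_strictConvexOn : StrictConvexOn ℝ (Ioo 0 1) weight := by
  refine StrictMonoOn.strictConvexOn_of_deriv (convex_Ioo 0 1)
    (fun s hs => (hasDerivAt_weight hs).continuousAt.continuousWithinAt) ?_
  rw [interior_Ioo]
  intro s hs t ht hst
  rw [(hasDerivAt_weight hs).deriv, (hasDerivAt_weight ht).deriv]
  have hq : quantile s < quantile t := by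
    rw [← cdfR_strictMono.lt_iff_lt, cdfR_quantile hs, cdfR_quantile ht]
    exact hst
  have hm : StrictMono fun x : ℝ => 2 * x / dens x ^ 3 := by
    refine strictMono_of_deriv_pos fun x => ?_
    have h := (((hasDerivAt_id x).const_mul 2).div ((hasDerivAt_dens x).pow 3)
      (pow_ne_zero 3 (dens_ne_zero x))).deriv
    refine lt_of_lt_of_eq ?_ h.symm
    have := dens_pos x
    simp only [id, Pi.pow_apply]
    refine div_pos ?_ (by positivity)
    have e : 2 * 1 * dens x ^ 3 - 2 * x * (((3 : ℕ) : ℝ) * dens x ^ (3 - 1) * (-x * dens x))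
        = (2 + 6 * x ^ 2) * dens x ^ 3 := by
      push_cast
      norm_num
      ring
    rw [e]
    positivity
  exact hm hq

/-! ### The Hardy quotient on a fixed interval -/

/-- Square integrable functions of mean zero on `(0, L)`. -/
structure IsMeanZero (L : ℝ) (U : ℝ → ℝ) : Prop where
  memLp : MemLp U 2 (volume.restrict (Ioo 0 L))
  integral_eq : ∫ t in Ioo 0 L, U t = 0

/-- The primitive of `U` on `(0, L)`. -/
noncomputable def prim (L : ℝ) (U : ℝ → ℝ) (t : ℝ) : ℝ :=
  ∫ y in Iio t, U y ∂volume.restrict (Ioo 0 L)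

/-- The weighted square norm of the primitive of `U`, with the weight shifted by `s`. -/
noncomputable def energy (L s : ℝ) (U : ℝ → ℝ) : ENNReal :=
  ∫⁻ t in Ioo 0 L, ENNReal.ofReal (weight (s + t) * prim L U t ^ 2)

/-- `Q` is the maximum of the quotient `energy L s U / ∫ U²`. -/
structure IsHardyConst (L s Q : ℝ) : Prop where
  pos : 0 < Q
  le : ∀ U, IsMeanZero L U → energy L s U ≤ ENNReal.ofReal (Q * ∫ t in Ioo 0 L, U t ^ 2)
  attained : ∃ U, IsMeanZero L U ∧ 0 < ∫ t in Ioo 0 L, U t ^ 2 ∧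
    energy L s U = ENNReal.ofReal (Q * ∫ t in Ioo 0 L, U t ^ 2)

theorem measurableEmbedding_cdfR_sub (c : ℝ) : MeasurableEmbedding fun x => cdfR x - c :=
  (continuous_cdfR.sub continuous_const).measurableEmbedding
    fun _ _ h => cdfR_strictMono.injective (sub_left_injective h)

/-- The distribution function has derivative `φ`, so it carries the Gaussian measure to Lebesgue
measure. Subtracting `cdfE a` places the image at `0`. -/
theorem measurePreserving_cdfR_sub (a b : EReal) :
    MeasurePreserving (fun x => cdfR x - cdfE a) (gauss.restrict (interval a b))
      (volume.restrict (Ioo 0 (cdfE b - cdfE a))) := by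
  have hme := measurableEmbedding_cdfR_sub (cdfE a)
  have hJ := (isOpen_interval a b).measurableSet
  have himg : (fun x => cdfR x - cdfE a) '' interval a b = Ioo 0 (cdfE b - cdfE a) := by
    ext s
    constructor
    · rintro ⟨x, hx, rfl⟩
      have h1 := cdfE_strictMono hx.1
      have h2 := cdfE_strictMono hx.2
      rw [cdfE_coe] at h1 h2
      constructor <;> linarith
    · rintro ⟨h1, h2⟩
      obtain ⟨x, hx⟩ := exists_cdfR_eq (s := s + cdfE a)
        ⟨by linarith [(cdfE_mem a).1], by linarith [(cdfE_mem b).2]⟩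
      refine ⟨x, ⟨?_, ?_⟩, ?_⟩
      · rw [← cdfE_strictMono.lt_iff_lt, cdfE_coe]; linarith
      · rw [← cdfE_strictMono.lt_iff_lt, cdfE_coe]; linarith
      · simp [hx]
  refine ⟨hme.measurable, ?_⟩
  ext A hA
  have h := lintegral_image_eq_lintegral_abs_deriv_mul hJ
    (fun x _ => ((hasDerivAt_cdfR x).sub_const (cdfE a)).hasDerivWithinAt) hme.injective.injOn
    (A.indicator 1)
  rw [himg, lintegral_indicator_one hA] at h
  rw [h, Measure.map_apply hme.measurable hA, ← lintegral_indicator_one (hme.measurable hA),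
    setLIntegral_gauss hJ]
  refine lintegral_congr fun x => ?_
  rw [abs_of_pos (dens_pos x)]
  rfl

theorem cumul_comp (a b : EReal) (U : ℝ → ℝ) (x : ℝ) :
    cumul (interval a b) (fun y => U (cdfR y - cdfE a)) x
      = prim (cdfE b - cdfE a) U (cdfR x - cdfE a) := by
  have h := (measurePreserving_cdfR_sub a b).setIntegral_preimage_emb
    (measurableEmbedding_cdfR_sub (cdfE a)) U (Iio (cdfR x - cdfE a))
  rw [cumul, prim, ← h]
  congr 2
  ext y
  simp [cdfR_strictMono.lt_iff_lt]

theorem lintegral_hardy_comp (a b : EReal) (U : ℝ → ℝ) :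
    ∫⁻ x in interval a b, ENNReal.ofReal
        (hardy (interval a b) (fun y => U (cdfR y - cdfE a)) x ^ 2) ∂gauss
      = energy (cdfE b - cdfE a) (cdfE a) U := by
  rw [energy, ← (measurePreserving_cdfR_sub a b).lintegral_comp_emb
    (measurableEmbedding_cdfR_sub (cdfE a))]
  refine lintegral_congr fun x => ?_
  rw [hardy, cumul_comp, add_sub_cancel, weight_cdfR]
  congr 1
  ring

/-- Composition with `Φ - Φ(a)` preserves means, `L²` norms and, up to the weight, the Hardy
quotient. Conversely, the maximizer on the interval is transported to `(0, L)` by `quantile`. -/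
theorem isHardyConst {a b : EReal} (hab : a < b) :
    IsHardyConst (cdfE b - cdfE a) (cdfE a)
      (‖hardyOp (isOpen_interval a b).measurableSet‖ ^ 2) := by
  have hJ := isOpen_interval a b
  have hoc := interval_ordConnected a b
  have hne := interval_nonempty hab
  have hmp := measurePreserving_cdfR_sub a b
  have hme := measurableEmbedding_cdfR_sub (cdfE a)
  have hpos := norm_hardyOp_pos hJ hne
  have hmem : ∀ U : ℝ → ℝ, MemLp U 2 (volume.restrict (Ioo 0 (cdfE b - cdfE a))) ↔
      MemLp (fun x => U (cdfR x - cdfE a)) 2 (gauss.restrict (interval a b)) := fun U => by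
    rw [← hmp.map_eq, hme.memLp_map_measure_iff]
    rfl
  have hval : ∀ (U : ℝ → ℝ) (u : meanZero (interval a b)),
      (u : L2Space (interval a b)) =ᵐ[gauss.restrict (interval a b)]
        (fun x => U (cdfR x - cdfE a)) →
      energy (cdfE b - cdfE a) (cdfE a) U = ENNReal.ofReal (‖hardyOp hJ.measurableSet u‖ ^ 2) ∧
      ∫ t in Ioo 0 (cdfE b - cdfE a), U t ^ 2 = ‖u‖ ^ 2 := by
    intro U u hu
    constructor
    · rw [ofReal_norm_hardyOp_sq, hardy_congr hu, lintegral_hardy_comp]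
    · rw [Submodule.coe_norm, norm_sq_eq_integral, ← hmp.integral_comp hme]
      refine integral_congr_ae ?_
      filter_upwards [hu] with x hx
      rw [hx]
  refine ⟨by positivity, fun U hU => ?_, ?_⟩
  · have hL := (hmem U).1 hU.memLp
    have hu : hL.toLp _ ∈ meanZero (interval a b) := by
      refine mem_meanZero_of_integral_eq_zero hJ hne ?_
      rw [integral_congr_ae hL.coeFn_toLp, hmp.integral_comp hme U, hU.integral_eq]
    obtain ⟨h1, h2⟩ := hval U ⟨_, hu⟩ hL.coeFn_toLp
    rw [h1, h2, ← mul_pow]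
    exact ENNReal.ofReal_le_ofReal (pow_le_pow_left₀ (norm_nonneg _)
      ((hardyOp hJ.measurableSet).le_opNorm _) 2)
  · obtain ⟨u, hu0, hu⟩ := exists_norm_hardyOp_eq hJ hne
    have he : ∀ x, (u : L2Space (interval a b)) x
        = (fun t => (u : L2Space (interval a b)) (quantile (t + cdfE a))) (cdfR x - cdfE a) := by
      intro x
      simp [quantile_cdfR]
    obtain ⟨h1, h2⟩ := hval (fun t => (u : L2Space (interval a b)) (quantile (t + cdfE a))) u
      (Filter.Eventually.of_forall he)
    refine ⟨fun t => (u : L2Space (interval a b)) (quantile (t + cdfE a)),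
      ⟨(hmem _).2 ?_, ?_⟩, ?_, ?_⟩
    · rw [← funext he]
      exact Lp.memLp _
    · rw [← hmp.integral_comp hme, ← funext he]
      exact integral_eq_zero_of_mem_meanZero hJ.measurableSet u.2
    · rw [h2]
      have := norm_pos_iff.2 hu0
      positivity
    · rw [h1, h2, hu, mul_pow]

namespace IsHardyConst

variable {L s Q : ℝ}

theorem le_of_le (h : IsHardyConst L s Q) {s' Q' : ℝ} (h' : IsHardyConst L s' Q')
    (hle : ∀ U, IsMeanZero L U → ∃ V, IsMeanZero L V ∧ energy L s' V = energy L s U ∧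
      ∫ t in Ioo 0 L, V t ^ 2 = ∫ t in Ioo 0 L, U t ^ 2) : Q ≤ Q' := by
  obtain ⟨U, hU, hpos, heq⟩ := h.attained
  obtain ⟨V, hV, h1, h2⟩ := hle U hU
  have h3 := h'.le V hV
  rw [h1, h2, heq, ENNReal.ofReal_le_ofReal_iff (mul_nonneg h'.pos.le hpos.le)] at h3
  exact le_of_mul_le_mul_right h3 hpos

theorem unique (h : IsHardyConst L s Q) {Q' : ℝ} (h' : IsHardyConst L s Q') : Q = Q' :=
  le_antisymm (h.le_of_le h' fun U hU => ⟨U, hU, rfl, rfl⟩)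
    (h'.le_of_le h fun U hU => ⟨U, hU, rfl, rfl⟩)

end IsHardyConst

/-! ### Reflection and strict convexity in the shift -/

theorem measurePreserving_reflect (L : ℝ) :
    MeasurePreserving (fun t => L - t) (volume.restrict (Ioo 0 L)) (volume.restrict (Ioo 0 L)) := by
  have h := (Measure.measurePreserving_sub_left (volume : Measure ℝ) L).restrict_preimage
    (measurableSet_Ioo (a := 0) (b := L))
  have e : (fun t => L - t) ⁻¹' Ioo 0 L = Ioo 0 L := by
    ext t
    simp [and_comm]
  rwa [e] at h

theorem measurableEmbedding_reflect (L : ℝ) : MeasurableEmbedding fun t : ℝ => L - t :=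
  (MeasurableEquiv.subLeft L).measurableEmbedding

/-- Because `U` has mean zero, reflecting it only changes the sign of the reflected primitive, and
the weight is symmetric about `1/2`. -/
theorem exists_reflect {L s : ℝ} (hs : s ∈ Icc 0 (1 - L)) {U : ℝ → ℝ} (hU : IsMeanZero L U) :
    ∃ V, IsMeanZero L V ∧ energy L (1 - L - s) V = energy L s U ∧
      ∫ t in Ioo 0 L, V t ^ 2 = ∫ t in Ioo 0 L, U t ^ 2 := by
  have hmp := measurePreserving_reflect L
  have hme := measurableEmbedding_reflect L
  refine ⟨fun t => U (L - t), ⟨?_, ?_⟩, ?_, ?_⟩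
  · exact hU.memLp.comp_measurePreserving hmp
  · rw [hmp.integral_comp hme U, hU.integral_eq]
  · have hprim : ∀ t, prim L (fun y => U (L - y)) (L - t) = - prim L U t := by
      intro t
      have h1 := hmp.setIntegral_preimage_emb hme U (Ioi t)
      have h2 : (fun y => L - y) ⁻¹' Ioi t = Iio (L - t) := by
        ext y
        simp only [mem_preimage, mem_Ioi, mem_Iio]
        constructor <;> intro h <;> linarith
      have h3 := integral_add_compl (measurableSet_Iio (a := t))
        (hU.memLp.integrable (by norm_num))
      rw [hU.integral_eq, compl_Iio, integral_Ici_eq_integral_Ioi] at h3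
      rw [prim, ← h2, h1, prim]
      linarith
    rw [energy, energy, ← hmp.lintegral_comp_emb hme]
    refine setLIntegral_congr_fun measurableSet_Ioo fun t ht => ?_
    have h4 : s + t ∈ Ioo (0 : ℝ) 1 := ⟨by linarith [hs.1, ht.1], by linarith [hs.2, ht.2]⟩
    show ENNReal.ofReal (weight (1 - L - s + (L - t)) * prim L (fun y => U (L - y)) (L - t) ^ 2) = _
    rw [hprim, ← weight_one_sub h4, neg_sq]
    congr 3
    ring
  · exact hmp.integral_comp hme fun t => U t ^ 2

namespace IsHardyConst

variable {L s Q : ℝ}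

theorem reflect (h : IsHardyConst L s Q) (hs : s ∈ Icc 0 (1 - L)) :
    IsHardyConst L (1 - L - s) Q := by
  refine ⟨h.pos, fun V hV => ?_, ?_⟩
  · obtain ⟨U, hU, h1, h2⟩ := exists_reflect (s := 1 - L - s) (by
      constructor <;> linarith [hs.1, hs.2]) hV
    rw [← h1, ← h2, sub_sub_cancel]
    exact h.le U hU
  · obtain ⟨U, hU, h1, h2⟩ := h.attained
    obtain ⟨V, hV, h3, h4⟩ := exists_reflect hs hU
    exact ⟨V, hV, by rwa [h4], by rwa [h3, h4]⟩

/-- The Hardy constant is a strictly convex function of the shift. -/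
theorem lt_combo {s₁ s₂ Q₁ Q₂ θ₁ θ₂ : ℝ} (h : IsHardyConst L (θ₁ * s₁ + θ₂ * s₂) Q)
    (h₁ : IsHardyConst L s₁ Q₁) (h₂ : IsHardyConst L s₂ Q₂)
    (hs₁ : s₁ ∈ Icc 0 (1 - L)) (hs₂ : s₂ ∈ Icc 0 (1 - L)) (hne : s₁ ≠ s₂)
    (hθ₁ : 0 < θ₁) (hθ₂ : 0 < θ₂) (hθ : θ₁ + θ₂ = 1) : Q < θ₁ * Q₁ + θ₂ * Q₂ := by
  -- The maximizer at the intermediate shift serves as a competitor at both `s₁` and `s₂`.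
  obtain ⟨U, hU, hpos, heq⟩ := h.attained
  have e₁ := h₁.le U hU
  have e₂ := h₂.le U hU
  set I := ∫ t in Ioo 0 L, U t ^ 2
  have hmem : ∀ s ∈ Icc 0 (1 - L), ∀ t ∈ Ioo 0 L, s + t ∈ Ioo (0 : ℝ) 1 := fun s hs t ht =>
    ⟨by linarith [hs.1, ht.1], by linarith [hs.2, ht.2]⟩
  have hprim : Measurable (prim L U) := by
    have hm := hU.memLp.aestronglyMeasurable
    have h1 : prim L U = prim L (hm.mk U) := by
      ext t
      exact integral_congr_ae (ae_restrict_of_ae hm.ae_eq_mk)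
    have h2 : prim L (hm.mk U) = fun x => ∫ y, (if y < x then hm.mk U y else 0)
        ∂volume.restrict (Ioo 0 L) := by
      ext x
      rw [prim, ← integral_indicator measurableSet_Iio]
      rfl
    rw [h1, h2]
    refine StronglyMeasurable.measurable (StronglyMeasurable.integral_prod_right ?_)
    refine StronglyMeasurable.ite (measurableSet_lt measurable_snd measurable_fst) ?_
      stronglyMeasurable_const
    exact hm.stronglyMeasurable_mk.comp_measurable measurable_snd
  have hw : ∀ s ∈ Icc 0 (1 - L), AEMeasurable (fun t => weight (s + t) * prim L U t ^ 2)
      (volume.restrict (Ioo 0 L)) := by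
    intro s hs
    refine AEMeasurable.mul ?_ (hprim.pow_const 2).aemeasurable
    refine ContinuousOn.aemeasurable (fun t ht => ?_) measurableSet_Ioo
    refine ContinuousAt.continuousWithinAt ?_
    exact ContinuousAt.comp (f := fun t => s + t)
      (hasDerivAt_weight (hmem s hs t ht)).continuousAt (by fun_prop)
  -- The Hardy bound makes each energy finite, so real integrals may replace lower integrals.
  have hint : ∀ {s Q' : ℝ}, s ∈ Icc 0 (1 - L) → 0 < Q' →
      energy L s U ≤ ENNReal.ofReal (Q' * I) →
      IntegrableOn (fun t => weight (s + t) * prim L U t ^ 2) (Ioo 0 L) ∧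
      ENNReal.ofReal (∫ t in Ioo 0 L, weight (s + t) * prim L U t ^ 2) = energy L s U := by
    intro s Q' hs hQ hle
    have hnn : 0 ≤ᵐ[volume.restrict (Ioo 0 L)] fun t => weight (s + t) * prim L U t ^ 2 :=
      Filter.Eventually.of_forall fun t => mul_nonneg (weight_pos _).le (sq_nonneg _)
    have hi : IntegrableOn (fun t => weight (s + t) * prim L U t ^ 2) (Ioo 0 L) := by
      refine ⟨(hw s hs).aestronglyMeasurable, ?_⟩
      rw [hasFiniteIntegral_iff_ofReal hnn]
      exact hle.trans_lt ENNReal.ofReal_lt_top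
    exact ⟨hi, ofReal_integral_eq_lintegral_ofReal hi hnn⟩
  have hs : θ₁ * s₁ + θ₂ * s₂ ∈ Icc 0 (1 - L) :=
    convex_Icc 0 (1 - L) hs₁ hs₂ hθ₁.le hθ₂.le hθ
  obtain ⟨i, j⟩ := hint hs h.pos heq.le
  obtain ⟨i₁, j₁⟩ := hint hs₁ h₁.pos e₁
  obtain ⟨i₂, j₂⟩ := hint hs₂ h₂.pos e₂
  have hQI := mul_pos h.pos hpos
  have hA : ∫ t in Ioo 0 L, weight (θ₁ * s₁ + θ₂ * s₂ + t) * prim L U t ^ 2 = Q * I := by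
    rw [← j, ENNReal.ofReal_eq_ofReal_iff _ hQI.le] at heq
    · exact heq
    · exact integral_nonneg fun t => mul_nonneg (weight_pos _).le (sq_nonneg _)
  rw [← j₁, ENNReal.ofReal_le_ofReal_iff (mul_pos h₁.pos hpos).le] at e₁
  rw [← j₂, ENNReal.ofReal_le_ofReal_iff (mul_pos h₂.pos hpos).le] at e₂
  have hconv : ∀ t ∈ Ioo 0 L, weight (θ₁ * s₁ + θ₂ * s₂ + t)
      < θ₁ * weight (s₁ + t) + θ₂ * weight (s₂ + t) := by
    intro t ht
    have := weight_strictConvexOn.2 (hmem s₁ hs₁ t ht) (hmem s₂ hs₂ t ht)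
      (fun hh => hne (add_right_cancel hh)) hθ₁ hθ₂ hθ
    simp only [smul_eq_mul] at this
    rwa [show θ₁ * (s₁ + t) + θ₂ * (s₂ + t) = θ₁ * s₁ + θ₂ * s₂ + t by linear_combination t * hθ]
      at this
  have hlt : ∫ t in Ioo 0 L, weight (θ₁ * s₁ + θ₂ * s₂ + t) * prim L U t ^ 2
      < ∫ t in Ioo 0 L, (θ₁ * (weight (s₁ + t) * prim L U t ^ 2)
        + θ₂ * (weight (s₂ + t) * prim L U t ^ 2)) := by
    have i₃ : IntegrableOn (fun t => θ₁ * (weight (s₁ + t) * prim L U t ^ 2)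
        + θ₂ * (weight (s₂ + t) * prim L U t ^ 2)) (Ioo 0 L) :=
      (i₁.const_mul θ₁).add (i₂.const_mul θ₂)
    rw [← sub_pos, ← integral_sub i₃ i]
    have hnn : 0 ≤ᵐ[volume.restrict (Ioo 0 L)] fun t =>
        θ₁ * (weight (s₁ + t) * prim L U t ^ 2) + θ₂ * (weight (s₂ + t) * prim L U t ^ 2)
          - weight (θ₁ * s₁ + θ₂ * s₂ + t) * prim L U t ^ 2 := by
      filter_upwards [ae_restrict_mem measurableSet_Ioo] with t ht
      have := mul_nonneg (sub_pos.2 (hconv t ht)).le (sq_nonneg (prim L U t))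
      show 0 ≤ _
      linarith
    -- Equality would force the primitive to vanish almost everywhere, against the positivity of `Q
    -- * I`.
    refine lt_of_le_of_ne (integral_nonneg_of_ae hnn) fun h0 => ?_
    rw [eq_comm, integral_eq_zero_iff_of_nonneg_ae hnn (i₃.sub i)] at h0
    have hz : ∫ t in Ioo 0 L, weight (θ₁ * s₁ + θ₂ * s₂ + t) * prim L U t ^ 2 = 0 := by
      rw [integral_eq_zero_iff_of_nonneg_ae _ i]
      · filter_upwards [h0, ae_restrict_mem measurableSet_Ioo] with t h0 ht
        have h1 : (θ₁ * weight (s₁ + t) + θ₂ * weight (s₂ + t)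
            - weight (θ₁ * s₁ + θ₂ * s₂ + t)) * prim L U t ^ 2 = 0 := by
          rw [Pi.zero_apply] at h0
          linarith
        rcases mul_eq_zero.1 h1 with h2 | h2
        · exact absurd h2 (sub_pos.2 (hconv t ht)).ne'
        · simp [h2]
      · exact Filter.Eventually.of_forall fun t => mul_nonneg (weight_pos _).le (sq_nonneg _)
    linarith
  rw [hA, integral_add (i₁.const_mul θ₁) (i₂.const_mul θ₂), integral_const_mul,
    integral_const_mul] at hlt
  have h3 : Q * I < (θ₁ * Q₁ + θ₂ * Q₂) * I := by
    nlinarith [mul_le_mul_of_nonneg_left e₁ hθ₁.le, mul_le_mul_of_nonneg_left e₂ hθ₂.le]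
  exact lt_of_mul_lt_mul_right h3 hpos.le

/-- The shift `s'` lies strictly between `s` and its mirror image `1 - L - s`. Both have the
constant `Q`, so strict convexity puts `Q'` below it. -/
theorem lt_of_lt {s' Q' : ℝ} (h : IsHardyConst L s Q) (h' : IsHardyConst L s' Q') (hs : 0 ≤ s)
    (hlt : s < s') (hle : s' ≤ (1 - L) / 2) : Q' < Q := by
  have hsI : s ∈ Icc 0 (1 - L) := ⟨hs, by linarith⟩
  have hr := h.reflect hsI
  have hd : 0 < 1 - L - s - s := by linarith
  have hcombo : (1 - L - s - s') / (1 - L - s - s) * s + (s' - s) / (1 - L - s - s) * (1 - L - s)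
      = s' := by
    field_simp
    ring
  have hsum : (1 - L - s - s') / (1 - L - s - s) + (s' - s) / (1 - L - s - s) = 1 := by
    field_simp
    ring
  rw [← hcombo] at h'
  have := h'.lt_combo h hr hsI ⟨by linarith, by linarith⟩ (by linarith)
    (div_pos (by linarith) hd) (div_pos (by linarith) hd) hsum
  rwa [← add_mul, hsum, one_mul] at this

end IsHardyConst

/-! ### The first nontrivial eigenvalue as a function of the left endpoint -/

theorem exists_isHardyConst {a b : EReal} (hab : a < b) :
    ∃ Q, IsHardyConst (cdfE b - cdfE a) (cdfE a) Q ∧ IsLeast (nontrivialEigenvalues a b) Q⁻¹ ∧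
      mu1 a b = Q⁻¹ := by
  have h := isLeast_nontrivialEigenvalues (interval_nonempty hab)
  exact ⟨_, isHardyConst hab, h, h.csInf_eq⟩

theorem cdfE_rightEnd {L : ℝ} (hL : L ∈ Ioo (0 : ℝ) 1) {a : EReal} (ha : cdfE a ≤ 1 - L) :
    cdfE (rightEnd L a) = L + cdfE a := by
  have h0 := (cdfE_mem a).1
  have h : erfE (((Real.sqrt 2 / 2 : ℝ) : EReal) * a) = 2 * cdfE a - 1 := by
    rw [cdfE]
    ring
  rw [rightEnd, h, cdfE_sqrtTwoErfInv ⟨by linarith [hL.1], by linarith⟩]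
  ring

theorem le_sqrtTwoErfInv_iff {y : ℝ} (hy : y ∈ Icc (-1 : ℝ) 1) (a : EReal) :
    a ≤ sqrtTwoErfInv y ↔ cdfE a ≤ (1 + y) / 2 := by
  rw [← cdfE_strictMono.le_iff_le, cdfE_sqrtTwoErfInv hy]

theorem eq_rightEnd_iff {L : ℝ} (hL : L ∈ Ioo (0 : ℝ) 1) {a : EReal} (ha : cdfE a ≤ 1 - L)
    (b : EReal) : b = rightEnd L a ↔ cdfE b = L + cdfE a := by
  rw [← cdfE_strictMono.injective.eq_iff, cdfE_rightEnd hL ha]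

theorem exists_isHardyConst_rightEnd {L : ℝ} (hL : L ∈ Ioo (0 : ℝ) 1) {a : EReal}
    (ha : cdfE a ≤ 1 - L) :
    ∃ Q, IsHardyConst L (cdfE a) Q ∧ IsLeast (nontrivialEigenvalues a (rightEnd L a)) Q⁻¹ ∧
      mu1 a (rightEnd L a) = Q⁻¹ := by
  have hr := cdfE_rightEnd hL ha
  have hab : a < rightEnd L a := by
    rw [← cdfE_strictMono.lt_iff_lt, hr]
    linarith [hL.1]
  have h := exists_isHardyConst hab
  rwa [hr, add_sub_cancel_right] at h

theorem mu1_lt_of_lt {L : ℝ} (hL : L ∈ Ioo (0 : ℝ) 1) {a a' : EReal} (hlt : cdfE a < cdfE a')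
    (hle : cdfE a' ≤ (1 - L) / 2) : mu1 a (rightEnd L a) < mu1 a' (rightEnd L a') := by
  obtain ⟨Q, hQ, -, h⟩ := exists_isHardyConst_rightEnd hL (a := a) (by linarith [hL.2])
  obtain ⟨Q', hQ', -, h'⟩ := exists_isHardyConst_rightEnd hL (a := a') (by linarith [hL.2])
  rw [h, h']
  exact inv_strictAnti₀ hQ'.pos (hQ.lt_of_lt hQ' (cdfE_mem a).1 hlt hle)

theorem mu1_reflect {L : ℝ} (hL : L ∈ Ioo (0 : ℝ) 1) {a a' : EReal} (ha : cdfE a ≤ 1 - L)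
    (haa' : cdfE a' = 1 - L - cdfE a) : mu1 a' (rightEnd L a') = mu1 a (rightEnd L a) := by
  obtain ⟨Q, hQ, -, h⟩ := exists_isHardyConst_rightEnd hL ha
  obtain ⟨Q', hQ', -, h'⟩ := exists_isHardyConst_rightEnd hL (a := a')
    (by linarith [(cdfE_mem a).1])
  rw [haa'] at hQ'
  rw [h, h', (hQ.reflect ⟨(cdfE_mem a).1, ha⟩).unique hQ']

/-- Reflection reduces the search for extrema to the left half, where monotonicity applies. -/
theorem exists_left_half {L : ℝ} (hL : L ∈ Ioo (0 : ℝ) 1) {a : EReal} (ha : cdfE a ≤ 1 - L) :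
    ∃ a', cdfE a' ≤ (1 - L) / 2 ∧ mu1 a (rightEnd L a) = mu1 a' (rightEnd L a') := by
  rcases le_or_gt (cdfE a) ((1 - L) / 2) with h | h
  · exact ⟨a, h, rfl⟩
  · obtain ⟨a', ha'⟩ := exists_cdfE_eq (s := 1 - L - cdfE a)
      ⟨by linarith, by linarith [(cdfE_mem a).1, hL.1]⟩
    exact ⟨a', by linarith, (mu1_reflect hL ha ha').symm⟩

theorem mu1_le_of_le {L : ℝ} (hL : L ∈ Ioo (0 : ℝ) 1) {a a' : EReal} (hle : cdfE a ≤ cdfE a')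
    (hle' : cdfE a' ≤ (1 - L) / 2) : mu1 a (rightEnd L a) ≤ mu1 a' (rightEnd L a') := by
  rcases hle.eq_or_lt with h | h
  · rw [cdfE_strictMono.injective h]
  · exact (mu1_lt_of_lt hL h hle').le

theorem gauss_interval_eq_iff {L : ℝ} (hL : L ∈ Ioo (0 : ℝ) 1) (a b : EReal) :
    (a < b ∧ gauss (interval a b) = ENNReal.ofReal L) ↔ (cdfE a ≤ 1 - L ∧ b = rightEnd L a) := by
  constructor
  · rintro ⟨hab, h⟩
    have hlt := cdfE_strictMono hab
    rw [gauss_interval a b hab.le, ENNReal.ofReal_eq_ofReal_iff (by linarith) hL.1.le] at h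
    have ha : cdfE a ≤ 1 - L := by linarith [(cdfE_mem b).2]
    exact ⟨ha, (eq_rightEnd_iff hL ha b).2 (by linarith)⟩
  · rintro ⟨ha, hb⟩
    rw [eq_rightEnd_iff hL ha] at hb
    have hab : a < b := by
      rw [← cdfE_strictMono.lt_iff_lt]
      linarith [hL.1]
    refine ⟨hab, ?_⟩
    rw [gauss_interval a b hab.le, hb, add_sub_cancel_right]

end GaussNeumann

/-! ### The theorem, with every endpoint translated into its mass -/

open GaussNeumann in
theorem theorem3p1 (L : ℝ) (hL : L ∈ Ioo (0 : ℝ) 1) :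
    -- the intervals of Gaussian measure `L` are the intervals `(a, b(a))`
    (∀ a b : EReal, (a < b ∧ gauss (interval a b) = ENNReal.ofReal L) ↔
      (a ≤ sqrtTwoErfInv (1 - 2 * L) ∧ b = rightEnd L a)) ∧
    -- the first nontrivial eigenvalue exists and is positive
    (∀ a : EReal, a ≤ sqrtTwoErfInv (1 - 2 * L) →
      0 < mu1 a (rightEnd L a) ∧
      IsLeast (nontrivialEigenvalues a (rightEnd L a)) (mu1 a (rightEnd L a))) ∧
    -- it is minimal on the two half-lines
    IsLeast ((fun a : EReal => mu1 a (rightEnd L a)) '' Iic (sqrtTwoErfInv (1 - 2 * L)))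
      (mu1 ⊥ (sqrtTwoErfInv (2 * L - 1))) ∧
    mu1 ⊥ (sqrtTwoErfInv (2 * L - 1)) = mu1 (sqrtTwoErfInv (1 - 2 * L)) ⊤ ∧
    -- it is maximal on the symmetric interval
    IsGreatest ((fun a : EReal => mu1 a (rightEnd L a)) '' Iic (sqrtTwoErfInv (1 - 2 * L)))
      (mu1 (-sqrtTwoErfInv L) (sqrtTwoErfInv L)) ∧
    -- it is strictly increasing up to the symmetric interval
    StrictMonoOn (fun a : EReal => mu1 a (rightEnd L a)) (Iic (-sqrtTwoErfInv L)) ∧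
    -- it is invariant under the reflection of the interval, and strictly decreasing afterwards
    (∀ a : EReal, a ≤ sqrtTwoErfInv (1 - 2 * L) →
      -rightEnd L a ≤ sqrtTwoErfInv (1 - 2 * L) ∧
      mu1 (-rightEnd L a) (rightEnd L (-rightEnd L a)) = mu1 a (rightEnd L a)) ∧
    StrictAntiOn (fun a : EReal => mu1 a (rightEnd L a))
      (Icc (-sqrtTwoErfInv L) (sqrtTwoErfInv (1 - 2 * L))) := by
  have c1 : (1 - 2 * L) ∈ Icc (-1 : ℝ) 1 := ⟨by linarith [hL.2], by linarith [hL.1]⟩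
  have c2 : (2 * L - 1) ∈ Icc (-1 : ℝ) 1 := ⟨by linarith [hL.1], by linarith [hL.2]⟩
  have c3 : L ∈ Icc (-1 : ℝ) 1 := ⟨by linarith [hL.1], hL.2.le⟩
  have hle : ∀ a : EReal, a ≤ sqrtTwoErfInv (1 - 2 * L) ↔ cdfE a ≤ 1 - L := fun a => by
    rw [le_sqrtTwoErfInv_iff c1, show (1 + (1 - 2 * L)) / 2 = 1 - L by ring]
  have hmax : cdfE (sqrtTwoErfInv (1 - 2 * L)) = 1 - L := by
    rw [cdfE_sqrtTwoErfInv c1]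
    ring
  have hbot0 : cdfE ⊥ ≤ 1 - L := by
    rw [cdfE_bot]
    linarith [hL.2]
  have hbot : sqrtTwoErfInv (2 * L - 1) = rightEnd L ⊥ := by
    rw [eq_rightEnd_iff hL hbot0, cdfE_sqrtTwoErfInv c2, cdfE_bot]
    ring
  have htop : ⊤ = rightEnd L (sqrtTwoErfInv (1 - 2 * L)) := by
    rw [eq_rightEnd_iff hL hmax.le, hmax, cdfE_top]
    ring
  have hmid : cdfE (-sqrtTwoErfInv L) = (1 - L) / 2 := by
    rw [cdfE_neg, cdfE_sqrtTwoErfInv c3]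
    ring
  have hmid0 : cdfE (-sqrtTwoErfInv L) ≤ 1 - L := by
    rw [hmid]
    linarith [hL.2]
  have hsym : sqrtTwoErfInv L = rightEnd L (-sqrtTwoErfInv L) := by
    rw [eq_rightEnd_iff hL hmid0, hmid, cdfE_sqrtTwoErfInv c3]
    ring
  refine ⟨fun a b => ?_, fun a ha => ?_, ?_, ?_, ?_, ?_, fun a ha => ?_, ?_⟩
  · rw [gauss_interval_eq_iff hL, hle]
  · obtain ⟨Q, hQ, hleast, h⟩ := exists_isHardyConst_rightEnd hL ((hle a).1 ha)
    rw [h]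
    exact ⟨inv_pos.2 hQ.pos, hleast⟩
  · rw [hbot]
    refine ⟨⟨⊥, mem_Iic.2 bot_le, rfl⟩, ?_⟩
    rintro _ ⟨a, ha, rfl⟩
    obtain ⟨a', h1, h2⟩ := exists_left_half hL ((hle a).1 ha)
    simp only [h2]
    exact mu1_le_of_le hL (by rw [cdfE_bot]; exact (cdfE_mem a').1) h1
  · rw [hbot, htop]
    exact (mu1_reflect hL hbot0 (by rw [hmax, cdfE_bot, sub_zero])).symm
  · have hval : mu1 (-sqrtTwoErfInv L) (sqrtTwoErfInv L)
        = mu1 (-sqrtTwoErfInv L) (rightEnd L (-sqrtTwoErfInv L)) := by rw [← hsym]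
    rw [hval]
    refine ⟨⟨-sqrtTwoErfInv L, (hle _).2 hmid0, rfl⟩, ?_⟩
    rintro _ ⟨a, ha, rfl⟩
    obtain ⟨a', h1, h2⟩ := exists_left_half hL ((hle a).1 ha)
    simp only [h2]
    exact mu1_le_of_le hL (by rwa [hmid]) hmid.le
  · intro a _ a' ha' haa'
    refine mu1_lt_of_lt hL (cdfE_strictMono haa') ?_
    rw [← hmid]
    exact cdfE_strictMono.monotone ha'
  · have h1 := (hle a).1 ha
    have h2 : cdfE (-rightEnd L a) = 1 - L - cdfE a := by
      rw [cdfE_neg, cdfE_rightEnd hL h1]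
      ring
    refine ⟨(hle _).2 ?_, mu1_reflect hL h1 h2⟩
    rw [h2]
    linarith [(cdfE_mem a).1]
  · intro a ha a' ha' haa'
    have h1 := (hle a).1 ha.2
    have h1' := (hle a').1 ha'.2
    have h2 := cdfE_strictMono.monotone ha.1
    rw [hmid] at h2
    have hlt := cdfE_strictMono haa'
    -- The mirror images of `a` and `a'` lie in the left half in reversed order, so the increasing
    -- case applies.
    obtain ⟨d, hd⟩ := exists_cdfE_eq (s := 1 - L - cdfE a)
      ⟨by linarith, by linarith [(cdfE_mem a).1, hL.1]⟩
    obtain ⟨d', hd'⟩ := exists_cdfE_eq (s := 1 - L - cdfE a')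
      ⟨by linarith, by linarith [(cdfE_mem a').1, hL.1]⟩
    show mu1 a' (rightEnd L a') < mu1 a (rightEnd L a)
    rw [← mu1_reflect hL h1 hd, ← mu1_reflect hL h1' hd']
    exact mu1_lt_of_lt hL (by linarith) (by linarith)
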